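/- Let $(M,d)$ be a global NPC (CAT(0), Hadamard) space, i.e. a complete metric space such that for all $x,y\in M$ there is $m\in M$ with $d^2(z,m)\le\frac12d^2(z,x)+\frac12d^2(z,y)-\frac14d^2(x,y)$ for all $z\in M$. Write $x\#_ty=\gamma_{x,y}(t)$, $t\in[0,1]$, where $\gamma_{x,y}:[0,1]\to M$ is the unique minimal geodesic from $x$ to $y$. Let $1\le p<\infty$. Let $\mathcal P^p(M)$ be the set of Borel probability measures $\mu$ on $M$ that are carried by their support and satisfy $\int_M d^p(x,y)\,d\mu(y)<\infty$ for some $x\in M$, and let $d_p^W$ be the $p$-Wasserstein distance on $\mathcal P^p(M)$, $d_p^W(\mu,\nu)=\bigl[\inf_\pi\int_{M\times M}d^p(x,y)\,d\pi(x,y)\bigr]^{1/p}$, with the infimum over all couplings $\pi$ of $\mu$ and $\nu$ (Borel probability measures on $M\times M$ carried by their support, with marginals $\mu,\nu$). Let $\mathcal C_p(M)$ be the set of $p$-contractive barycentric maps, i.e. maps $\beta:\mathcal P^p(M)\to M$ with $\beta(\delta_x)=x$ for all $x\in M$ and $d(\beta(\mu),\beta(\nu))\le d_p^W(\mu,\nu)$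 for all $\mu,\nu\in\mathcal P^p(M)$, equipped with the distance $$d_p(\beta_1,\beta_2)=\sup\Bigl\{\frac{d(\beta_1(\mathbf x),\beta_2(\mathbf x))}{\Delta(\mathbf x)}:\ n\ge1,\ \mathbf x=(x_1,\dots,x_n)\in M^n,\ \Delta(\mathbf x)\ne0\Bigr\},$$ where $\beta(\mathbf x)=\beta\bigl(\frac1n\sum_{j=1}^n\delta_{x_j}\bigr)$ and $\Delta(\mathbf x)$ is the diameter of $\{x_1,\dots,x_n\}$. For $x\in M$, $t\in[0,1]$ and $\mu\in\mathcal P^p(M)$ let $x\#_t\mu$ be the push-forward of $\mu$ by $a\mapsto x\#_ta$. Let $k_2=2$ and, for $q>2$, $k_q=\frac{8}{2^q}\,\frac{1+\tau_q^{q-1}}{(1+\tau_q)^{q-1}}$, where $\tau_q$ is the unique solution in $(1,\infty)$ of $x^{q-1}+(1-q)x+2-q=0$. Theorem. One has $x\#_t\mu\in\mathcal P^p(M)$ for all $x\in M$, $t\in[0,1]$, $\mu\in\mathcal P^p(M)$, and there is a map $\Phi_p:(0,1]\times\mathcal C_p(M)\to\mathcal C_p(M)$ which is a continuous semiflow for the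 multiplicative semigroup $(0,1]$ (that is, $\Phi_p$ is jointly continuous, $\Phi_p(1,\beta)=\beta$, and $\Phi_p(t,\Phi_p(s,\beta))=\Phi_p(ts,\beta)$) and which satisfies $$x=\Phi_p(t,\beta)(\mu)\iff x=\beta(x\#_t\mu)$$ for all $t\in(0,1]$, $\beta\in\mathcal C_p(M)$, $\mu\in\mathcal P^p(M)$ and $x\in M$. Furthermore, for all $s,t\in(0,1]$ and $\beta\in\mathcal C_p(M)$, $$d_p\bigl(\Phi_p(t,\beta),\Phi_p(s,\beta)\bigr)\le\left[\frac{k_{2p}(s+t)+2(2-k_{2p})}{4}\right]^{\frac1{2p}}.$$ If $p=1$, then for every $\beta\in\mathcal C_1(M)$ one has $\lim_{t\to0^+}\Phi_1(t,\beta)=\lambda$ with respect to $d_1$, where $\lambda\in\mathcal C_1(M)$ is the canonical barycentric map: for every $\mu\in\mathcal P^1(M)$ and every $y\in M$, $\lambda(\mu)$ is the unique minimizer of $z\mapsto\int_M[d^2(z,x)-d^2(y,x)]\,d\mu(x)$ over $z\in M$. -/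

import Mathlib

open MeasureTheory Set Filter Topology
open scoped ENNReal

noncomputable section

/-! ### Global NPC spaces and their geodesics -/

/-- A global NPC space (also called a CAT(0) or Hadamard space): a complete metric space in which
every two points `x, y` admit a point `m` satisfying the Bruhat-Tits (CN) inequality. -/
structure IsGlobalNPC (M : Type*) [MetricSpace M] : Prop where
  complete : CompleteSpace M
  exists_midpoint : ∀ x y : M, ∃ m : M, ∀ z : M,
    dist z m ^ 2 ≤ (1 / 2) * dist z x ^ 2 + (1 / 2) * dist z y ^ 2 - (1 / 4) * dist x y ^ 2

/-- `γ`, restricted to `[0,1]`, is a minimal geodesic from `x` to `y`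
(parametrized proportionally to arc length). -/
def IsMinimalGeodesic {M : Type*} [MetricSpace M] (γ : ℝ → M) (x y : M) : Prop :=
  γ 0 = x ∧ γ 1 = y ∧
    ∀ s ∈ Icc (0 : ℝ) 1, ∀ t ∈ Icc (0 : ℝ) 1, dist (γ s) (γ t) = |s - t| * dist x y

open Classical in
/-- The point `x #_t y = γ(t)` (`0 ≤ t ≤ 1`) of the minimal geodesic `γ` from `x` to `y`.
In a global NPC space the minimal geodesic exists and is unique on `[0,1]`; the `else` branch is
never used there. -/
def geodPoint {M : Type*} [MetricSpace M] (x : M) (t : ℝ) (y : M) : M :=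
  if h : ∃ γ : ℝ → M, IsMinimalGeodesic γ x y then h.choose t else x

/-- The measure `x #_t μ`, the push-forward of `μ` by `a ↦ x #_t a`. -/
def geodMeasure {M : Type*} [MetricSpace M] [MeasurableSpace M] (x : M) (t : ℝ)
    (μ : Measure M) : Measure M :=
  μ.map (fun a => geodPoint x t a)

/-! ### Probability measures with finite `p`-th moment, Wasserstein distance -/

/-- `μ` is carried by its topological support. (This is automatic on separable metric spaces;
on a metric space it means that `μ` has separable support of full measure.) -/
def HasFullSupport {X : Type*} [TopologicalSpace X] [MeasurableSpace X] (μ : Measure X) : Prop :=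
  μ (μ.support)ᶜ = 0

/-- `μ` is a Borel probability measure carried by its support and
`∫ d(x,y)^p dμ(y) < ∞` for some `x`. -/
structure IsProbPMoment {M : Type*} [MetricSpace M] [MeasurableSpace M] (p : ℝ)
    (μ : Measure M) : Prop where
  isProb : IsProbabilityMeasure μ
  fullSupport : HasFullSupport μ
  moment : ∃ x : M, ∫⁻ y, edist x y ^ p ∂μ < ∞

/-- The set `𝒫^p(M)`. -/
def ProbP (p : ℝ) (M : Type*) [MetricSpace M] [MeasurableSpace M] : Type _ :=
  {μ : Measure M // IsProbPMoment p μ}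

/-- The couplings of `μ` and `ν`: Borel probability measures on the topological space `M × M`,
carried by their support, with marginals `μ` and `ν`. (For nonseparable `M` the Borel
`σ`-algebra of `M × M` may be larger than the product `σ`-algebra, hence it is written out.) -/
def couplings {M : Type*} [MetricSpace M] [MeasurableSpace M] (μ ν : Measure M) :
    Set (@Measure (M × M) (borel (M × M))) :=
  {π | @IsProbabilityMeasure (M × M) (borel (M × M)) π ∧
    @HasFullSupport (M × M) _ (borel (M × M)) π ∧
    (∀ B : Set M, MeasurableSet B → π (B ×ˢ univ) = μ B) ∧
    (∀ B : Set M, MeasurableSet B → π (univ ×ˢ B) = ν B)}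

/-- The `p`-Wasserstein distance `d_p^W(μ,ν) = [inf_π ∫ d(x,y)^p dπ(x,y)]^{1/p}`, with values in
`[0,∞]`. -/
def wassersteinDist {M : Type*} [MetricSpace M] [MeasurableSpace M] (p : ℝ)
    (μ ν : Measure M) : ℝ≥0∞ :=
  (⨅ π ∈ couplings μ ν, @lintegral (M × M) (borel (M × M)) π (fun z => edist z.1 z.2 ^ p))
    ^ (1 / p)

/-- The uniform measure `(1/(n+1)) ∑_j δ_{x_j}` on the `n+1` points `x_0, …, x_n`. -/
def uniformOn {M : Type*} [MeasurableSpace M] {n : ℕ} (x : Fin (n + 1) → M) : Measure M :=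
  ((n + 1 : ℕ) : ℝ≥0∞)⁻¹ • ∑ j, Measure.dirac (x j)

/-- Uniform measures on finite families belong to `𝒫^p(M)`. -/
lemma uniformOn_isProbPMoment {M : Type*} [MetricSpace M] [MeasurableSpace M] [BorelSpace M]
    {p : ℝ} (hp : 0 ≤ p) {n : ℕ} (x : Fin (n + 1) → M) : IsProbPMoment p (uniformOn x) := by
  have hn : ((n + 1 : ℕ) : ℝ≥0∞) ≠ 0 := by exact_mod_cast Nat.succ_ne_zero n
  have hn' : ((n + 1 : ℕ) : ℝ≥0∞) ≠ ∞ := ENNReal.natCast_ne_top _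
  refine ⟨⟨?_⟩, ?_, x 0, ?_⟩
  · simp only [uniformOn, Measure.smul_apply, Measure.finsetSum_apply, measure_univ,
      Finset.sum_const, Finset.card_univ, Fintype.card_fin, smul_eq_mul, nsmul_eq_mul, mul_one]
    exact ENNReal.inv_mul_cancel hn hn'
  · have hx : ∀ j, x j ∈ (uniformOn x).support := by
      intro j
      rw [Measure.mem_support_iff_forall]
      intro U hU
      have h1 : Measure.dirac (x j) U = 1 := Measure.dirac_apply_of_mem (mem_of_mem_nhds hU)
      have h2 : (1 : ℝ≥0∞) ≤ ∑ i, Measure.dirac (x i) U := by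
        rw [← h1]
        exact Finset.single_le_sum (f := fun i => Measure.dirac (x i) U)
          (fun _ _ => zero_le) (Finset.mem_univ j)
      simp only [uniformOn, Measure.smul_apply, Measure.finsetSum_apply, smul_eq_mul]
      exact ENNReal.mul_pos (ENNReal.inv_ne_zero.2 hn') (zero_lt_one.trans_le h2).ne'
    have hm : MeasurableSet ((uniformOn x).support)ᶜ :=
      Measure.isOpen_compl_support.measurableSet
    unfold HasFullSupport
    have h0 : ∀ j, Measure.dirac (x j) ((uniformOn x).support)ᶜ = 0 := by
      intro j
      rw [Measure.dirac_apply' _ hm]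
      simp [hx j]
    generalize (uniformOn x).support = S at *
    simp [uniformOn, h0]
  · simp only [uniformOn, lintegral_smul_measure, lintegral_finsetSum_measure,
      lintegral_dirac, smul_eq_mul]
    refine ENNReal.mul_lt_top (ENNReal.inv_lt_top.2 (pos_iff_ne_zero.2 hn)) ?_
    exact ENNReal.sum_lt_top.2
      (fun j _ => ENNReal.rpow_lt_top_of_nonneg hp (edist_ne_top _ _))

/-! ### Contractive barycentric maps -/

/-- `β : 𝒫^p(M) → M` is a `p`-contractive barycentric map: `β(δ_x) = x` for all `x`, and
`d(β(μ),β(ν)) ≤ d_p^W(μ,ν)` for all `μ, ν ∈ 𝒫^p(M)`. -/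
structure IsContractiveBarycentric {M : Type*} [MetricSpace M] [MeasurableSpace M] {p : ℝ}
    (β : ProbP p M → M) : Prop where
  map_dirac : ∀ (x : M) (μ : ProbP p M), μ.1 = Measure.dirac x → β μ = x
  contractive : ∀ μ ν : ProbP p M, edist (β μ) (β ν) ≤ wassersteinDist p μ.1 ν.1

/-- The set `𝒞_p(M)` of `p`-contractive barycentric maps. -/
def ContractiveBary (p : ℝ) (M : Type*) [MetricSpace M] [MeasurableSpace M] : Type _ :=
  {β : ProbP p M → M // IsContractiveBarycentric β}

/-- `d_p(β₁,β₂) = sup d(β₁(𝐱),β₂(𝐱)) / Δ(𝐱)`, the supremum being over all finite nonempty families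
`𝐱` of points with diameter `Δ(𝐱) ≠ 0`, where `β(𝐱)` is the value of `β` at the uniform measure
on `𝐱`. The value is in `[0,∞]`. (The condition `h` is always satisfied when `0 ≤ p`.) -/
def baryEDist {p : ℝ} {M : Type*} [MetricSpace M] [MeasurableSpace M]
    (β₁ β₂ : ContractiveBary p M) : ℝ≥0∞ :=
  ⨆ (n : ℕ) (x : Fin (n + 1) → M) (h : IsProbPMoment p (uniformOn x))
    (_ : Metric.diam (range x) ≠ 0),
    edist (β₁.1 ⟨uniformOn x, h⟩) (β₂.1 ⟨uniformOn x, h⟩) / ENNReal.ofReal (Metric.diam (range x))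

/-- `𝒞_p(M)` carries the distance `d_p` and its topology. -/
instance {p : ℝ} {M : Type*} [MetricSpace M] [MeasurableSpace M] :
    PseudoEMetricSpace (ContractiveBary p M) where
  edist := baryEDist
  edist_self β := by simp [baryEDist]
  edist_comm β₁ β₂ := by simp only [baryEDist, edist_comm]
  edist_triangle β₁ β₂ β₃ := by
    refine iSup_le fun n => iSup_le fun x => iSup_le fun h => iSup_le fun hx => ?_
    refine (ENNReal.div_le_div_right (edist_triangle _ (β₂.1 ⟨uniformOn x, h⟩) _) _).trans ?_
    rw [ENNReal.add_div]
    refine add_le_add ?_ ?_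
    · exact le_iSup_of_le n (le_iSup_of_le x (le_iSup_of_le h (le_iSup_of_le hx le_rfl)))
    · exact le_iSup_of_le n (le_iSup_of_le x (le_iSup_of_le h (le_iSup_of_le hx le_rfl)))

/-- `β` is the canonical barycentric map: for every `μ` and every base point `y`, the point
`β(μ)` is the unique minimizer of `z ↦ ∫ [d(z,x)² - d(y,x)²] dμ(x)`. (For `μ ∈ 𝒫^1(M)` the
integrand is integrable.) -/
def IsCanonicalBarycentricMap {p : ℝ} {M : Type*} [MetricSpace M] [MeasurableSpace M]
    (β : ContractiveBary p M) : Prop :=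
  ∀ (μ : ProbP p M) (y z : M), z ≠ β.1 μ →
    ∫ x, (dist (β.1 μ) x ^ 2 - dist y x ^ 2) ∂μ.1 < ∫ x, (dist z x ^ 2 - dist y x ^ 2) ∂μ.1

/-! ### The uniform convexity constants -/

/-- For `q > 2` the equation `x^{q-1} + (1-q) x + 2 - q = 0` has a unique solution in `(1,∞)`. -/
lemma existsUnique_tau {q : ℝ} (hq : 2 < q) :
    ∃! x : ℝ, 1 < x ∧ x ^ (q - 1) + (1 - q) * x + 2 - q = 0 := by
  have hcont : ContinuousOn (fun x : ℝ => x ^ (q - 1) + (1 - q) * x + 2 - q) (Ici 1) := by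
    have : ContinuousOn (fun x : ℝ => x ^ (q - 1)) (Ici 1) :=
      continuousOn_id.rpow_const fun x _ => Or.inr (by linarith)
    fun_prop
  obtain ⟨X, hX1, hX⟩ : ∃ X : ℝ, 1 ≤ X ∧ 0 ≤ X ^ (q - 1) + (1 - q) * X + 2 - q := by
    have h1 : (1 : ℝ) ≤ (2 * q) ^ (1 / (q - 2)) :=
      Real.one_le_rpow (by linarith) (by have : 0 < q - 2 := by linarith
                                         positivity)
    refine ⟨(2 * q) ^ (1 / (q - 2)), h1, ?_⟩
    set X := (2 * q) ^ (1 / (q - 2)) with hXdef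
    have h2 : X ^ (q - 2) = 2 * q := by
      rw [hXdef, ← Real.rpow_mul (by linarith), one_div_mul_cancel (by linarith), Real.rpow_one]
    have h3 : X ^ (q - 1) = 2 * q * X := by
      rw [show q - 1 = (q - 2) + 1 by ring, Real.rpow_add_one (by linarith), h2]
    rw [h3]
    nlinarith
  have hmem : (0 : ℝ) ∈ Icc ((1 : ℝ) ^ (q - 1) + (1 - q) * 1 + 2 - q)
      (X ^ (q - 1) + (1 - q) * X + 2 - q) := by
    refine ⟨?_, hX⟩
    rw [Real.one_rpow]; linarith
  obtain ⟨a, ha, ha0⟩ := intermediate_value_Icc hX1 (hcont.mono Icc_subset_Ici_self) hmem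
  have key : ∀ u v : ℝ, 1 < u → u < v → v ^ (q - 1) + (1 - q) * v + 2 - q = 0 →
      u ^ (q - 1) + (1 - q) * u + 2 - q < 0 := by
    intro u v hu huv hv
    have hd : 0 < v - 1 := by linarith
    have hc := (convexOn_rpow (show 1 ≤ q - 1 by linarith)).2 (mem_Ici.2 zero_le_one)
      (mem_Ici.2 (show (0 : ℝ) ≤ v by linarith))
      (div_nonneg (show 0 ≤ v - u by linarith) hd.le)
      (div_nonneg (show 0 ≤ u - 1 by linarith) hd.le)
      (by field_simp; ring)
    have hu' : ((v - u) / (v - 1)) • (1 : ℝ) + ((u - 1) / (v - 1)) • v = u := by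
      simp only [smul_eq_mul]; field_simp; ring
    rw [hu'] at hc
    simp only [Real.one_rpow, smul_eq_mul, mul_one] at hc
    have hv' : v ^ (q - 1) = (q - 1) * v + q - 2 := by linarith
    rw [hv'] at hc
    have h5 : (v - u) / (v - 1) + (u - 1) / (v - 1) * ((q - 1) * v + q - 2)
        = (q - 1) * u + q - 2 - (2 * q - 4) * ((v - u) / (v - 1)) := by
      field_simp; ring
    have h6 : 0 < (v - u) / (v - 1) := div_pos (by linarith) hd
    nlinarith
  refine ⟨a, ⟨lt_of_le_of_ne ha.1 ?_, ha0⟩, ?_⟩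
  · rintro rfl
    simp only [Real.one_rpow] at ha0
    linarith
  · rintro b ⟨hb1, hb0⟩
    have ha1 : 1 ≤ a := ha.1
    rcases lt_trichotomy b a with h | h | h
    · exact absurd hb0 (key b a hb1 h ha0).ne
    · exact h
    · rcases ha1.lt_or_eq with h1 | h1
      · exact absurd ha0 (key a b h1 h hb0).ne
      · subst h1
        simp only [Real.one_rpow] at ha0
        linarith

open Classical in
/-- `τ_q`, the unique solution in `(1,∞)` of `x^{q-1} + (1-q) x + 2 - q = 0`, for `q > 2`
(and `1` otherwise). -/
def convexityTau (q : ℝ) : ℝ :=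
  if hq : 2 < q then (existsUnique_tau hq).choose else 1

/-- `k_2 = 2` and `k_q = (8/2^q) (1 + τ_q^{q-1}) / (1 + τ_q)^{q-1}` for `q > 2`. -/
def convexityConst (q : ℝ) : ℝ :=
  if q = 2 then 2
  else 8 / 2 ^ q * ((1 + convexityTau q ^ (q - 1)) / (1 + convexityTau q) ^ (q - 1))

end

/-!
The CN inequality gives `d(x #_t a, y #_t b) ≤ (1 - t) d(x, y) + t d(a, b)`. Hence
`x ↦ β(x #_t μ)` is a `(1 - t)`-contraction of the complete space `M`, and `Φ_p(t, β)(μ)` is its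
fixed point, which depends on `μ` as contractively as `β` does; the semigroup law is
`x #_s (x #_t a) = x #_{st} a` together with uniqueness of fixed points.

For `q ≥ 2` the function `d(z, ·)^q` is uniformly convex along geodesics with constant `k_q`.
Writing `k = k_{2p}`, let `u = Φ_p(t, β)(𝐱)` and `v = Φ_p(s, β)(𝐱)`. As `v = β(v #_s 𝐱)`,
contractivity of `β` (against `δ_z`) and uniform convexity give a variance inequality
`d(z, v)^{2p} ≤ 𝔼_j d(z, x_j)^{2p} - (k / 2) (1 - s) 𝔼_j d(v, x_j)^{2p}`.
The estimate is the sum of this inequality at `z = u` and the corresponding one for `u` at `z = v`.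

For `p = 1`, the functional defining `λ(μ)` is strongly convex along geodesics, so its minimizer
exists and satisfies the variance inequality with `s = 0`, and `λ` is contractive by Reshetnyak's
quadruple comparison. Adding the variance inequalities of `Φ_1(t, β)` and `λ` yields
`d_1(Φ_1(t, β), λ) ≤ √t`.
-/

/-! ### Geodesics in global NPC spaces -/

lemma Icc_subset_of_isClosed_of_midpoint_mem {S : Set ℝ} (hS : IsClosed S)
    (hmid : ∀ s ∈ S, ∀ t ∈ S, (s + t) / 2 ∈ S) {a b : ℝ} (ha : a ∈ S) (hb : b ∈ S) :
    Icc a b ⊆ S := by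
  rintro t ⟨hat, htb⟩
  by_contra htS
  obtain ⟨l, ⟨hlS, hal, hlt⟩, hl⟩ := (isCompact_Icc.inter_left hS).exists_isGreatest
    (⟨a, ha, le_rfl, hat⟩ : (S ∩ Icc a t).Nonempty)
  obtain ⟨r, ⟨hrS, htr, hrb⟩, hr⟩ := (isCompact_Icc.inter_left hS).exists_isLeast
    (⟨b, hb, htb, le_rfl⟩ : (S ∩ Icc t b).Nonempty)
  have hl_lt : l < t := hlt.lt_of_ne fun h => htS (h ▸ hlS)
  have hlt_r : t < r := htr.lt_of_ne fun h => htS (h ▸ hrS)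
  have hm := hmid l hlS r hrS
  rcases le_total ((l + r) / 2) t with h | h
  · linarith [hl ⟨hm, by linarith, h⟩]
  · linarith [hr ⟨hm, h, by linarith⟩]

/-- `w` satisfies the NPC inequality expected of the point at parameter `t` of a geodesic from `x`
to `y`. For `t = 1/2` this is the inequality of `IsGlobalNPC.exists_midpoint`; for `t ∈ [0,1]` it
determines `w`, which makes it a handle on the geodesics before they are known to exist. -/
def IsNPCPoint {M : Type*} [MetricSpace M] (x y : M) (t : ℝ) (w : M) : Prop :=
  ∀ z, dist z w ^ 2 ≤ (1 - t) * dist z x ^ 2 + t * dist z y ^ 2 - t * (1 - t) * dist x y ^ 2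

section Geodesic

variable {M : Type*} [MetricSpace M]

namespace IsNPCPoint

variable {x y v w : M} {s t : ℝ}

lemma left (x y : M) : IsNPCPoint x y 0 x := fun z => by simp

lemma right (x y : M) : IsNPCPoint x y 1 y := fun z => by simp

lemma dist_left_le (hw : IsNPCPoint x y t w) (ht : 0 ≤ t) : dist x w ≤ t * dist x y := by
  refine (sq_le_sq₀ dist_nonneg (by positivity)).1 ?_
  have := hw x
  rw [dist_self] at this
  linarith

lemma dist_right_le (hw : IsNPCPoint x y t w) (ht : t ≤ 1) : dist w y ≤ (1 - t) * dist x y := by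
  have : 0 ≤ 1 - t := sub_nonneg.2 ht
  rw [dist_comm w y]
  refine (sq_le_sq₀ dist_nonneg (by positivity)).1 ?_
  have := hw y
  rw [dist_self, dist_comm y x] at this
  linarith

lemma dist_le_of_dist_le (hw : IsNPCPoint x y t w) (ht : t ∈ Icc (0 : ℝ) 1)
    (hx : dist x v ≤ s * dist x y) (hy : dist v y ≤ (1 - s) * dist x y) :
    dist v w ≤ |s - t| * dist x y := by
  have hx2 := mul_le_mul_of_nonneg_left (pow_le_pow_left₀ dist_nonneg hx 2) (sub_nonneg.2 ht.2)
  have hy2 := mul_le_mul_of_nonneg_left (pow_le_pow_left₀ dist_nonneg hy 2) ht.1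
  refine (sq_le_sq₀ dist_nonneg (by positivity)).1 ?_
  calc dist v w ^ 2
      ≤ (1 - t) * dist x v ^ 2 + t * dist v y ^ 2 - t * (1 - t) * dist x y ^ 2 := by
        rw [dist_comm x v]; exact hw v
    _ ≤ (1 - t) * (s * dist x y) ^ 2 + t * ((1 - s) * dist x y) ^ 2
          - t * (1 - t) * dist x y ^ 2 := by gcongr
    _ = (|s - t| * dist x y) ^ 2 := by rw [mul_pow |s - t|, sq_abs]; ring

lemma eq_of_dist_le (hw : IsNPCPoint x y t w) (ht : t ∈ Icc (0 : ℝ) 1)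
    (hx : dist x v ≤ t * dist x y) (hy : dist v y ≤ (1 - t) * dist x y) : v = w := by
  simpa using hw.dist_le_of_dist_le ht hx hy

lemma dist_eq (hv : IsNPCPoint x y s v) (hw : IsNPCPoint x y t w) (hs : s ∈ Icc (0 : ℝ) 1)
    (ht : t ∈ Icc (0 : ℝ) 1) : dist v w = |s - t| * dist x y := by
  wlog hst : s ≤ t generalizing s t v w
  · rw [dist_comm, abs_sub_comm]
    exact this hw hv ht hs (le_of_not_ge hst)
  refine (hw.dist_le_of_dist_le ht (hv.dist_left_le hs.1) (hv.dist_right_le hs.2)).antisymm ?_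
  rw [abs_of_nonpos (sub_nonpos.2 hst)]
  linarith [dist_triangle4 x v w y, hv.dist_left_le hs.1, hw.dist_right_le ht.2]

lemma midpoint {m : M} (hv : IsNPCPoint x y s v) (hw : IsNPCPoint x y t w)
    (hs : s ∈ Icc (0 : ℝ) 1) (ht : t ∈ Icc (0 : ℝ) 1) (hm : IsNPCPoint v w (1 / 2) m) :
    IsNPCPoint x y ((s + t) / 2) m := by
  intro z
  have hmz := hm z
  rw [hv.dist_eq hw hs ht, mul_pow, sq_abs] at hmz
  linarith [hv z, hw z]

lemma of_tendsto {ι : Type*} {l : Filter ι} [l.NeBot] {u : ι → ℝ} {p : ι → M}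
    (hp : ∀ i, IsNPCPoint x y (u i) (p i)) (hu : Tendsto u l (𝓝 t)) (hpw : Tendsto p l (𝓝 w)) :
    IsNPCPoint x y t w := fun z =>
  le_of_tendsto_of_tendsto' ((tendsto_const_nhds.dist hpw).pow 2)
    ((((tendsto_const_nhds.sub hu).mul_const _).add (hu.mul_const _)).sub
      ((hu.mul (tendsto_const_nhds.sub hu)).mul_const _)) fun i => hp i z

lemma isClosed_setOf_exists [CompleteSpace M] (x y : M) :
    IsClosed {t | t ∈ Icc (0 : ℝ) 1 ∧ ∃ w, IsNPCPoint x y t w} := by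
  refine isClosed_of_closure_subset fun t ht => ?_
  obtain ⟨u, hu, hut⟩ := mem_closure_iff_seq_limit.1 ht
  choose hu01 p hp using hu
  have hcauchy : CauchySeq p := by
    have hdist := (cauchySeq_iff_tendsto_dist_atTop_0.1 hut.cauchySeq).mul_const (dist x y)
    rw [zero_mul] at hdist
    refine cauchySeq_iff_tendsto_dist_atTop_0.2 (hdist.congr fun n => ?_)
    rw [(hp n.1).dist_eq (hp n.2) (hu01 n.1) (hu01 n.2), Real.dist_eq]
  obtain ⟨w, hw⟩ := cauchySeq_tendsto_of_complete hcauchy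
  exact ⟨isClosed_Icc.mem_of_tendsto hut (.of_forall hu01), w, of_tendsto hp hut hw⟩

lemma eq_of_isMinimalGeodesic {γ : ℝ → M} (hw : IsNPCPoint x y t w)
    (hγ : IsMinimalGeodesic γ x y) (ht : t ∈ Icc (0 : ℝ) 1) : γ t = w := by
  obtain ⟨hγ0, hγ1, hγd⟩ := hγ
  refine hw.eq_of_dist_le ht (le_of_eq ?_) (le_of_eq ?_)
  · rw [← hγ0, hγd 0 (by simp) t ht, zero_sub, abs_neg, abs_of_nonneg ht.1, hγ0]
  · rw [← hγ1, hγd t ht 1 (by simp), abs_sub_comm, abs_of_nonneg (sub_nonneg.2 ht.2), hγ1]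

end IsNPCPoint

lemma IsGlobalNPC.exists_isNPCPoint (hM : IsGlobalNPC M) (x y : M) {t : ℝ}
    (ht : t ∈ Icc (0 : ℝ) 1) : ∃ w, IsNPCPoint x y t w := by
  have := hM.complete
  refine (Icc_subset_of_isClosed_of_midpoint_mem (IsNPCPoint.isClosed_setOf_exists x y) ?_
    ⟨by simp, x, .left x y⟩ ⟨by simp, y, .right x y⟩ ht).2
  rintro s ⟨hs, v, hv⟩ t ⟨ht, w, hw⟩
  obtain ⟨m, hm⟩ := hM.exists_midpoint v w
  refine ⟨⟨by linarith [hs.1, ht.1], by linarith [hs.2, ht.2]⟩, m, ?_⟩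
  exact hv.midpoint hw hs ht fun z => by linarith [hm z]

lemma IsGlobalNPC.exists_isMinimalGeodesic (hM : IsGlobalNPC M) (x y : M) :
    ∃ γ : ℝ → M, IsMinimalGeodesic γ x y := by
  have (t : ℝ) : ∃ w, t ∈ Icc (0 : ℝ) 1 → IsNPCPoint x y t w := by
    by_cases ht : t ∈ Icc (0 : ℝ) 1
    · obtain ⟨w, hw⟩ := hM.exists_isNPCPoint x y ht
      exact ⟨w, fun _ => hw⟩
    · exact ⟨x, fun h => absurd h ht⟩
  choose γ hγ using this
  have h0 : (0 : ℝ) ∈ Icc (0 : ℝ) 1 := by simp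
  have h1 : (1 : ℝ) ∈ Icc (0 : ℝ) 1 := by simp
  refine ⟨γ, ?_, ?_, fun s hs t ht => (hγ s hs).dist_eq (hγ t ht) hs ht⟩
  · exact ((hγ 0 h0).eq_of_dist_le h0 (by simp) (by simp)).symm
  · exact ((hγ 1 h1).eq_of_dist_le h1 (by simp) (by simp)).symm

lemma IsGlobalNPC.isMinimalGeodesic_geodPoint (hM : IsGlobalNPC M) (x y : M) :
    IsMinimalGeodesic (fun t => geodPoint x t y) x y := by
  have h := hM.exists_isMinimalGeodesic x y
  simp only [geodPoint, dif_pos h]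
  exact h.choose_spec

lemma IsGlobalNPC.isNPCPoint_geodPoint (hM : IsGlobalNPC M) (x y : M) {t : ℝ}
    (ht : t ∈ Icc (0 : ℝ) 1) : IsNPCPoint x y t (geodPoint x t y) := by
  obtain ⟨w, hw⟩ := hM.exists_isNPCPoint x y ht
  rwa [hw.eq_of_isMinimalGeodesic (hM.isMinimalGeodesic_geodPoint x y) ht]

lemma IsGlobalNPC.eq_geodPoint (hM : IsGlobalNPC M) {x y v : M} {t : ℝ} (ht : t ∈ Icc (0 : ℝ) 1)
    (hx : dist x v ≤ t * dist x y) (hy : dist v y ≤ (1 - t) * dist x y) : v = geodPoint x t y :=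
  (hM.isNPCPoint_geodPoint x y ht).eq_of_dist_le ht hx hy

lemma IsGlobalNPC.dist_geodPoint_geodPoint (hM : IsGlobalNPC M) (x y : M) {s t : ℝ}
    (hs : s ∈ Icc (0 : ℝ) 1) (ht : t ∈ Icc (0 : ℝ) 1) :
    dist (geodPoint x s y) (geodPoint x t y) = |s - t| * dist x y :=
  (hM.isMinimalGeodesic_geodPoint x y).2.2 s hs t ht

lemma IsGlobalNPC.geodPoint_zero (hM : IsGlobalNPC M) (x y : M) : geodPoint x 0 y = x :=
  (hM.isMinimalGeodesic_geodPoint x y).1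

lemma IsGlobalNPC.geodPoint_one (hM : IsGlobalNPC M) (x y : M) : geodPoint x 1 y = y :=
  (hM.isMinimalGeodesic_geodPoint x y).2.1

lemma IsGlobalNPC.dist_left_geodPoint (hM : IsGlobalNPC M) (x y : M) {t : ℝ}
    (ht : t ∈ Icc (0 : ℝ) 1) : dist x (geodPoint x t y) = t * dist x y := by
  have := hM.dist_geodPoint_geodPoint x y (s := 0) (by simp) ht
  rwa [hM.geodPoint_zero, zero_sub, abs_neg, abs_of_nonneg ht.1] at this

lemma IsGlobalNPC.dist_geodPoint_right (hM : IsGlobalNPC M) (x y : M) {t : ℝ}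
    (ht : t ∈ Icc (0 : ℝ) 1) : dist (geodPoint x t y) y = (1 - t) * dist x y := by
  have := hM.dist_geodPoint_geodPoint x y (t := 1) ht (by simp)
  rwa [hM.geodPoint_one, abs_sub_comm, abs_of_nonneg (sub_nonneg.2 ht.2)] at this

lemma IsGlobalNPC.geodPoint_symm (hM : IsGlobalNPC M) (x y : M) {t : ℝ}
    (ht : t ∈ Icc (0 : ℝ) 1) : geodPoint x t y = geodPoint y (1 - t) x := by
  refine hM.eq_geodPoint ⟨by linarith [ht.2], by linarith [ht.1]⟩ ?_ ?_
  · rw [dist_comm, hM.dist_geodPoint_right x y ht, dist_comm]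
  · rw [dist_comm, hM.dist_left_geodPoint x y ht, dist_comm x y, sub_sub_cancel]

lemma IsGlobalNPC.geodPoint_geodPoint (hM : IsGlobalNPC M) (x y : M) {s t : ℝ}
    (hs : s ∈ Icc (0 : ℝ) 1) (ht : t ∈ Icc (0 : ℝ) 1) :
    geodPoint x s (geodPoint x t y) = geodPoint x (t * s) y := by
  refine hM.eq_geodPoint ⟨mul_nonneg ht.1 hs.1, mul_le_one₀ ht.2 hs.1 hs.2⟩ ?_ ?_
  · rw [hM.dist_left_geodPoint _ _ hs, hM.dist_left_geodPoint _ _ ht, ← mul_assoc, mul_comm s]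
  · refine (dist_triangle _ (geodPoint x t y) _).trans (le_of_eq ?_)
    rw [hM.dist_geodPoint_right _ _ hs, hM.dist_geodPoint_right _ _ ht,
      hM.dist_left_geodPoint _ _ ht]
    ring

lemma IsGlobalNPC.dist_geodPoint_right_le (hM : IsGlobalNPC M) (x a b : M) {t : ℝ}
    (ht : t ∈ Icc (0 : ℝ) 1) :
    dist (geodPoint x t a) (geodPoint x t b) ≤ t * dist a b := by
  have hb := hM.isNPCPoint_geodPoint x b ht (geodPoint x t a)
  have ha := mul_le_mul_of_nonneg_left (hM.isNPCPoint_geodPoint x a ht b) ht.1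
  rw [dist_comm (geodPoint x t a) x, hM.dist_left_geodPoint x a ht,
    dist_comm (geodPoint x t a) b] at hb
  rw [dist_comm b x, dist_comm b a] at ha
  refine (sq_le_sq₀ dist_nonneg (mul_nonneg ht.1 dist_nonneg)).1 ?_
  linarith

lemma IsGlobalNPC.dist_geodPoint_le (hM : IsGlobalNPC M) (x y a b : M) {t : ℝ}
    (ht : t ∈ Icc (0 : ℝ) 1) :
    dist (geodPoint x t a) (geodPoint y t b) ≤ (1 - t) * dist x y + t * dist a b := by
  have hxy := hM.dist_geodPoint_right_le b x y (t := 1 - t)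
    ⟨by linarith [ht.2], by linarith [ht.1]⟩
  rw [← hM.geodPoint_symm x b ht, ← hM.geodPoint_symm y b ht] at hxy
  linarith [dist_triangle (geodPoint x t a) (geodPoint x t b) (geodPoint y t b),
    hM.dist_geodPoint_right_le x a b ht]

lemma IsGlobalNPC.continuous_geodPoint (hM : IsGlobalNPC M) (x : M) {t : ℝ}
    (ht : t ∈ Icc (0 : ℝ) 1) : Continuous fun a => geodPoint x t a :=
  (LipschitzWith.of_dist_le_mul (K := ⟨t, ht.1⟩)
    fun a b => hM.dist_geodPoint_right_le x a b ht).continuous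

/-- Reshetnyak's quadruple comparison. -/
lemma IsGlobalNPC.dist_sq_add_dist_sq_le (hM : IsGlobalNPC M) (a b c d : M) :
    dist a c ^ 2 + dist b d ^ 2 ≤
      dist a d ^ 2 + dist b c ^ 2 + 2 * dist a b * dist c d := by
  rcases eq_or_ne a b with rfl | hab
  · simp only [dist_self]; linarith
  rcases eq_or_ne c d with rfl | hcd
  · simp only [dist_self]; linarith
  set l := dist a b with hl_def
  set m := dist c d with hm_def
  have hl : 0 < l := dist_pos.2 hab
  have hm : 0 < m := dist_pos.2 hcd
  -- the point dividing the diagonal `b d` in the ratio `l : m` of the sides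
  set w := geodPoint b (l / (l + m)) d
  have hw := hM.isNPCPoint_geodPoint b d (t := l / (l + m))
    ⟨by positivity, div_le_one_of_le₀ (by linarith) (by positivity)⟩
  have hcompl : 1 - l / (l + m) = m / (l + m) := by field_simp; ring
  rw [IsNPCPoint, hcompl] at hw
  have haw := hw a
  have hcw := hw c
  rw [← hl_def] at haw
  rw [← hm_def, dist_comm c b, dist_comm c] at hcw
  have htitu : (dist a w + dist w c) ^ 2 / (l + m) ≤ dist a w ^ 2 / l + dist w c ^ 2 / m := by
    simpa [Fin.sum_univ_two] using Finset.sq_sum_div_le_sum_sq_div Finset.univ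
      ![dist a w, dist w c] (g := ![l, m]) (by simp [Fin.forall_fin_two, hl, hm])
  suffices dist a c ^ 2 / (l + m) ≤
      (dist a d ^ 2 + dist b c ^ 2 + 2 * l * m - dist b d ^ 2) / (l + m) by
    linarith [(div_le_div_iff_of_pos_right (add_pos hl hm)).1 this]
  calc dist a c ^ 2 / (l + m)
      ≤ (dist a w + dist w c) ^ 2 / (l + m) := by gcongr; exact dist_triangle a w c
    _ ≤ dist a w ^ 2 / l + dist w c ^ 2 / m := htitu
    _ ≤ (m / (l + m) * l ^ 2 + l / (l + m) * dist a d ^ 2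
            - l / (l + m) * (m / (l + m)) * dist b d ^ 2) / l
          + (m / (l + m) * dist b c ^ 2 + l / (l + m) * m ^ 2
            - l / (l + m) * (m / (l + m)) * dist b d ^ 2) / m := by gcongr
    _ = _ := by field_simp; ring

end Geodesic

/-! ### Uniform convexity of the distance -/

section Convexity

lemma rpow_eq_rpow_sub_one_mul {x q : ℝ} (hx : 0 ≤ x) (hq : q ≠ 0) : x ^ q = x ^ (q - 1) * x := by
  rw [← Real.rpow_add_one' hx (by rwa [sub_add_cancel]), sub_add_cancel]

lemma abs_rpow_eq_sq_rpow (x q : ℝ) : |x| ^ q = (x ^ 2) ^ (q / 2) := by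
  rw [← sq_abs, ← Real.rpow_natCast_mul (abs_nonneg x), Nat.cast_ofNat,
    mul_div_cancel₀ q two_ne_zero]

/-- The best constant `c` in the gradient inequality
`|y|^q ≥ |w|^q + q |w|^(q-2) w (y - w) + c |y - w|^q` on the real line. -/
noncomputable def gradConst (q : ℝ) : ℝ :=
  (1 + convexityTau q ^ (q - 1)) / (1 + convexityTau q) ^ (q - 1)

variable {q : ℝ}

lemma one_lt_convexityTau (hq : 2 < q) : 1 < convexityTau q := by
  rw [convexityTau, dif_pos hq]
  exact (existsUnique_tau hq).choose_spec.1.1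

lemma convexityTau_rpow (hq : 2 < q) :
    convexityTau q ^ (q - 1) = (q - 1) * convexityTau q + q - 2 := by
  rw [convexityTau, dif_pos hq]
  linarith [(existsUnique_tau hq).choose_spec.1.2]

lemma gradConst_nonneg (hq : 2 < q) : 0 ≤ gradConst q := by
  have := one_lt_convexityTau hq
  unfold gradConst
  positivity

lemma gradConst_le_one (hq : 2 < q) : gradConst q ≤ 1 := by
  have hτ := one_lt_convexityTau hq
  refine (div_le_one (by positivity)).2 ?_
  simpa only [Real.one_rpow] using Real.add_rpow_le_rpow_add zero_le_one
    (show 0 ≤ convexityTau q by linarith) (show 1 ≤ q - 1 by linarith)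

lemma convexOn_tauPoly (hq : 2 ≤ q) :
    ConvexOn ℝ (Ici 0) fun s : ℝ => s ^ (q - 1) + ((1 - q) * s + 2 - q) := by
  refine (convexOn_rpow (by linarith)).add ⟨convex_Ici 0, fun x _ y _ a b _ _ hab => le_of_eq ?_⟩
  simp only [smul_eq_mul]
  linear_combination (q - 2) * hab

lemma tauPoly_nonpos (hq : 2 < q) {s : ℝ} (hs : 0 ≤ s) (hsτ : s ≤ convexityTau q) :
    s ^ (q - 1) + ((1 - q) * s + 2 - q) ≤ 0 := by
  have hτ := one_lt_convexityTau hq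
  refine ((convexOn_tauPoly hq.le).le_max_of_mem_Icc (mem_Ici.2 le_rfl)
    (mem_Ici.2 (by linarith)) ⟨hs, hsτ⟩).trans (max_le ?_ ?_)
  · rw [Real.zero_rpow (by linarith)]; linarith
  · rw [convexityTau_rpow hq]; linarith

lemma tauPoly_nonneg (hq : 2 < q) {s : ℝ} (hτs : convexityTau q ≤ s) :
    0 ≤ s ^ (q - 1) + ((1 - q) * s + 2 - q) := by
  have hτ := one_lt_convexityTau hq
  have hzero : convexityTau q ^ (q - 1) + ((1 - q) * convexityTau q + 2 - q) = 0 := by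
    rw [convexityTau_rpow hq]; ring
  refine hzero.ge.trans <| (convexOn_tauPoly hq.le).le_right_of_left_le'' (mem_Ici.2 le_rfl)
    (mem_Ici.2 (by linarith)) (zero_lt_one.trans hτ) hτs ?_
  rw [hzero, Real.zero_rpow (by linarith)]
  linarith

/-- The quotient whose minimum over `s ≥ 0`, attained at `τ_q`, is `gradConst q`; it is the gradient
inequality at `1` solved for the constant, at the point `y = -s`. -/
noncomputable def gradQuotient (q s : ℝ) : ℝ := (s ^ q + q * s + q - 1) / (1 + s) ^ q

lemma gradQuotient_convexityTau (hq : 2 < q) : gradQuotient q (convexityTau q) = gradConst q := by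
  have hτ := one_lt_convexityTau hq
  have : 0 < (1 + convexityTau q) ^ (q - 1) := by positivity
  rw [gradQuotient, gradConst, rpow_eq_rpow_sub_one_mul (by linarith) (by linarith),
    rpow_eq_rpow_sub_one_mul (x := 1 + _) (by linarith) (by linarith), convexityTau_rpow hq]
  field_simp
  ring

lemma hasDerivAt_gradQuotient (hq : 1 ≤ q) {s : ℝ} (hs : 0 ≤ s) :
    HasDerivAt (gradQuotient q)
      (q * (1 + s) ^ (q - 1) * (s ^ (q - 1) + ((1 - q) * s + 2 - q)) / ((1 + s) ^ q) ^ 2) s := by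
  have hpos : 0 < 1 + s := by linarith
  have hnum : HasDerivAt (fun s : ℝ => s ^ q + q * s + q - 1) (q * s ^ (q - 1) + q) s := by
    simpa using (((Real.hasDerivAt_rpow_const (Or.inr hq)).add
      ((hasDerivAt_id s).const_mul q)).add_const q).sub_const 1
  have hden : HasDerivAt (fun s : ℝ => (1 + s) ^ q) (q * (1 + s) ^ (q - 1)) s := by
    simpa using ((hasDerivAt_id s).const_add 1).rpow_const (p := q) (Or.inl hpos.ne')
  refine (hnum.div hden (by positivity)).congr_deriv ?_
  have hq0 : q ≠ 0 := by linarith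
  rw [rpow_eq_rpow_sub_one_mul hs hq0, rpow_eq_rpow_sub_one_mul hpos.le hq0]
  ring

lemma gradConst_le_gradQuotient (hq : 2 < q) {s : ℝ} (hs : 0 ≤ s) :
    gradConst q ≤ gradQuotient q s := by
  have hτ := one_lt_convexityTau hq
  have hderiv {u : ℝ} (hu : 0 ≤ u) := hasDerivAt_gradQuotient (by linarith : 1 ≤ q) hu
  rw [← gradQuotient_convexityTau hq]
  refine isMinOn_Ici_of_deriv (hderiv le_rfl).continuousAt (hderiv (by linarith)).continuousAt
    (fun u hu => (hderiv hu.1.le).differentiableAt.differentiableWithinAt)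
    (fun u hu => (hderiv (by linarith [mem_Ioi.1 hu])).differentiableAt.differentiableWithinAt)
    (fun u hu => ?_) (fun u hu => ?_) hs
  · have hu0 : 0 < u := hu.1
    rw [(hderiv hu0.le).deriv]
    exact div_nonpos_of_nonpos_of_nonneg (mul_nonpos_of_nonneg_of_nonpos (by positivity)
      (tauPoly_nonpos hq hu0.le hu.2.le)) (by positivity)
  · have hu0 : 0 < u := by linarith [mem_Ioi.1 hu]
    rw [(hderiv hu0.le).deriv]
    exact div_nonneg (mul_nonneg (by positivity) (tauPoly_nonneg hq (mem_Ioi.1 hu).le))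
      (by positivity)

lemma one_add_mul_add_abs_rpow_le_of_nonpos (hq : 2 < q) {y : ℝ} (hy : y ≤ 0) :
    1 + q * (y - 1) + gradConst q * |y - 1| ^ q ≤ |y| ^ q := by
  have h := gradConst_le_gradQuotient hq (neg_nonneg.2 hy)
  rw [gradQuotient, le_div_iff₀ (by have := neg_nonneg.2 hy; positivity)] at h
  rw [abs_of_nonpos hy, abs_of_nonpos (by linarith), show -(y - 1) = 1 + -y by ring]
  linarith

lemma one_add_mul_add_abs_rpow_le_of_mem_Icc (hq : 2 ≤ q) {y : ℝ} (hy : y ∈ Icc (0 : ℝ) 1) :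
    1 + q * (y - 1) + |y - 1| ^ q ≤ |y| ^ q := by
  have hsq : |y - 1| ^ q ≤ (y - 1) ^ 2 := by
    rw [← sq_abs, ← Real.rpow_two]
    refine Real.rpow_le_rpow_of_exponent_ge' (abs_nonneg _) ?_ zero_le_two hq
    rw [abs_of_nonpos (by linarith [hy.2])]
    linarith [hy.1]
  have hbernoulli := one_add_mul_self_le_rpow_one_add (s := y ^ 2 - 1) (by nlinarith)
    (show 1 ≤ q / 2 by linarith)
  rw [add_sub_cancel, ← abs_rpow_eq_sq_rpow] at hbernoulli
  nlinarith [sq_nonneg (y - 1)]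

lemma one_add_mul_add_abs_rpow_le_of_one_le (hq : 2 ≤ q) {y : ℝ} (hy : 1 ≤ y) :
    1 + q * (y - 1) + |y - 1| ^ q ≤ |y| ^ q := by
  have hbernoulli := one_add_mul_self_le_rpow_one_add (s := 2 * (y - 1)) (by linarith)
    (show 1 ≤ q / 2 by linarith)
  have hsuper := Real.add_rpow_le_rpow_add (show 0 ≤ 1 + 2 * (y - 1) by linarith)
    (sq_nonneg (y - 1)) (show 1 ≤ q / 2 by linarith)
  rw [← abs_rpow_eq_sq_rpow, show 1 + 2 * (y - 1) + (y - 1) ^ 2 = y ^ 2 by ring,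
    ← abs_rpow_eq_sq_rpow] at hsuper
  linarith

lemma one_add_mul_add_abs_rpow_le (hq : 2 < q) (y : ℝ) :
    1 + q * (y - 1) + gradConst q * |y - 1| ^ q ≤ |y| ^ q := by
  rcases le_or_gt y 0 with hy | hy
  · exact one_add_mul_add_abs_rpow_le_of_nonpos hq hy
  have hgrad : gradConst q * |y - 1| ^ q ≤ |y - 1| ^ q :=
    mul_le_of_le_one_left (by positivity) (gradConst_le_one hq)
  rcases le_total y 1 with hy1 | hy1
  · linarith [one_add_mul_add_abs_rpow_le_of_mem_Icc hq.le ⟨hy.le, hy1⟩]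
  · linarith [one_add_mul_add_abs_rpow_le_of_one_le hq.le hy1]

lemma exists_abs_rpow_add_mul_add_le (hq : 2 < q) (w : ℝ) :
    ∃ D : ℝ, ∀ z, |w| ^ q + D * (z - w) + gradConst q * |z - w| ^ q ≤ |z| ^ q := by
  rcases eq_or_ne w 0 with rfl | hw
  · refine ⟨0, fun z => ?_⟩
    simpa [Real.zero_rpow (show q ≠ 0 by linarith)] using
      mul_le_of_le_one_left (by positivity : 0 ≤ |z| ^ q) (gradConst_le_one hq)
  refine ⟨|w| ^ q * q / w, fun z => ?_⟩
  have hscale (u : ℝ) : |w| ^ q * |u| ^ q = |w * u| ^ q := by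
    rw [abs_mul, Real.mul_rpow (abs_nonneg _) (abs_nonneg _)]
  calc |w| ^ q + |w| ^ q * q / w * (z - w) + gradConst q * |z - w| ^ q
      = |w| ^ q * (1 + q * (z / w - 1) + gradConst q * |z / w - 1| ^ q) := by
        rw [show z - w = w * (z / w - 1) by field_simp, ← hscale]
        field_simp
    _ ≤ |w| ^ q * |z / w| ^ q := by gcongr; exact one_add_mul_add_abs_rpow_le hq _
    _ = |z| ^ q := by rw [hscale, mul_div_cancel₀ z hw]

lemma mul_one_sub_mul_le_rpow_add_rpow (hq : 2 ≤ q) {t : ℝ} (ht : t ∈ Icc (0 : ℝ) 1) :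
    4 / 2 ^ q * (t * (1 - t)) ≤ (1 - t) * t ^ q + t * (1 - t) ^ q := by
  obtain ⟨ht0, ht1⟩ := ht
  have ht1' : 0 ≤ 1 - t := sub_nonneg.2 ht1
  have hconv := (convexOn_rpow (show 1 ≤ q - 1 by linarith)).2 (mem_Ici.2 ht0) (mem_Ici.2 ht1')
    (show (0 : ℝ) ≤ 2⁻¹ by norm_num) (show (0 : ℝ) ≤ 2⁻¹ by norm_num) (by norm_num)
  simp only at hconv
  rw [← smul_add, add_sub_cancel, smul_eq_mul, mul_one, Real.inv_rpow zero_le_two,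
    Real.rpow_sub_one two_ne_zero, inv_div, smul_eq_mul, smul_eq_mul] at hconv
  calc 4 / 2 ^ q * (t * (1 - t)) = 2 * (2 / 2 ^ q) * (t * (1 - t)) := by ring
    _ ≤ (t ^ (q - 1) + (1 - t) ^ (q - 1)) * (t * (1 - t)) := by
        gcongr; linarith
    _ = (1 - t) * t ^ q + t * (1 - t) ^ q := by
        rw [rpow_eq_rpow_sub_one_mul ht0 (by linarith : q ≠ 0),
          rpow_eq_rpow_sub_one_mul ht1' (by linarith : q ≠ 0)]
        ring

lemma abs_rpow_add_mul_abs_sub_rpow_le (hq : 2 < q) {t : ℝ} (ht : t ∈ Icc (0 : ℝ) 1) (x y : ℝ) :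
    |(1 - t) * x + t * y| ^ q + 4 / 2 ^ q * gradConst q * (t * (1 - t)) * |x - y| ^ q ≤
      (1 - t) * |x| ^ q + t * |y| ^ q := by
  have ht' : 0 ≤ 1 - t := sub_nonneg.2 ht.2
  set w := (1 - t) * x + t * y with hw
  obtain ⟨D, hD⟩ := exists_abs_rpow_add_mul_add_le hq w
  have hxw : |x - w| ^ q = t ^ q * |x - y| ^ q := by
    rw [show x - w = t * (x - y) by rw [hw]; ring, abs_mul, abs_of_nonneg ht.1,
      Real.mul_rpow ht.1 (abs_nonneg _)]
  have hyw : |y - w| ^ q = (1 - t) ^ q * |x - y| ^ q := by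
    rw [show y - w = (1 - t) * (y - x) by rw [hw]; ring, abs_mul, abs_of_nonneg ht',
      Real.mul_rpow ht' (abs_nonneg _), abs_sub_comm]
  have hgrad := add_le_add (mul_le_mul_of_nonneg_left (hD x) ht')
    (mul_le_mul_of_nonneg_left (hD y) ht.1)
  have hcoeff := mul_le_mul_of_nonneg_right (mul_one_sub_mul_le_rpow_add_rpow hq.le ht)
    (mul_nonneg (gradConst_nonneg hq) (show 0 ≤ |x - y| ^ q by positivity))
  have hlinear : (1 - t) * (D * (x - w)) + t * (D * (y - w)) = 0 := by rw [hw]; ring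
  rw [hxw, hyw] at hgrad
  linarith

lemma sq_rpow_add_mul_sq_rpow_le (hq : 2 < q) {t : ℝ} (ht : t ∈ Icc (0 : ℝ) 1) (x y : ℝ) :
    (((1 - t) * x + t * y) ^ 2) ^ (q / 2)
        + 4 / 2 ^ q * gradConst q * (t * (1 - t)) * ((x - y) ^ 2) ^ (q / 2) ≤
      (1 - t) * |x| ^ q + t * |y| ^ q := by
  simpa only [← abs_rpow_eq_sq_rpow] using abs_rpow_add_mul_abs_sub_rpow_le hq ht x y

/-- The inequality for a triangle with sides `a, b, c`. Both summands are convex functions of `c²`,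
which lies between its values `(a - b)²` and `(a + b)²` for degenerate triangles. -/
lemma triangle_rpow_le (hq : 2 < q) {t : ℝ} (ht : t ∈ Icc (0 : ℝ) 1) {a b c : ℝ}
    (ha : 0 ≤ a) (hb : 0 ≤ b) (hc : 0 ≤ c) (hab : |a - b| ≤ c) (hcab : c ≤ a + b) :
    ((1 - t) * a ^ 2 + t * b ^ 2 - t * (1 - t) * c ^ 2) ^ (q / 2)
        + 4 / 2 ^ q * gradConst q * (t * (1 - t)) * c ^ q ≤ (1 - t) * a ^ q + t * b ^ q := by
  set K := 4 / 2 ^ q * gradConst q * (t * (1 - t)) with hK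
  have hK0 : 0 ≤ K := mul_nonneg (mul_nonneg (by positivity) (gradConst_nonneg hq))
    (mul_nonneg ht.1 (sub_nonneg.2 ht.2))
  have hminus := sq_rpow_add_mul_sq_rpow_le hq ht a b
  have hplus := sq_rpow_add_mul_sq_rpow_le hq ht a (-b)
  rw [abs_neg] at hplus
  rw [abs_of_nonneg ha, abs_of_nonneg hb, ← hK] at hminus hplus
  obtain ⟨α, β, hα, hβ, hαβ, hcomb⟩ : c ^ 2 ∈ segment ℝ ((a - b) ^ 2) ((a - -b) ^ 2) := by
    have hlower : (a - b) ^ 2 ≤ c ^ 2 := by rw [← sq_abs (a - b)]; gcongr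
    have hupper : c ^ 2 ≤ (a - -b) ^ 2 := by rw [sub_neg_eq_add]; gcongr
    rw [segment_eq_Icc (hlower.trans hupper)]
    exact ⟨hlower, hupper⟩
  have hconv := convexOn_rpow (show 1 ≤ q / 2 by linarith)
  have hside := hconv.2 (mem_Ici.2 (sq_nonneg (a - b))) (mem_Ici.2 (sq_nonneg (a - -b))) hα hβ hαβ
  have hmedian := hconv.2 (mem_Ici.2 (sq_nonneg ((1 - t) * a + t * b)))
    (mem_Ici.2 (sq_nonneg ((1 - t) * a + t * -b))) hα hβ hαβ
  simp only [smul_eq_mul] at hside hmedian hcomb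
  rw [hcomb] at hside
  rw [show α * ((1 - t) * a + t * b) ^ 2 + β * ((1 - t) * a + t * -b) ^ 2
      = (1 - t) * a ^ 2 + t * b ^ 2 - t * (1 - t) * c ^ 2 by
    rw [← hcomb, eq_sub_of_add_eq hαβ]; ring] at hmedian
  rw [show c ^ q = (c ^ 2) ^ (q / 2) by rw [← abs_rpow_eq_sq_rpow, abs_of_nonneg hc]]
  calc _ ≤ _ := add_le_add hmedian (mul_le_mul_of_nonneg_left hside hK0)
    _ ≤ α * ((1 - t) * a ^ q + t * b ^ q) + β * ((1 - t) * a ^ q + t * b ^ q) := by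
        linarith [mul_le_mul_of_nonneg_left hminus hα, mul_le_mul_of_nonneg_left hplus hβ]
    _ = (1 - t) * a ^ q + t * b ^ q := by rw [← add_mul, hαβ, one_mul]

lemma convexityConst_two : convexityConst 2 = 2 := if_pos rfl

lemma convexityConst_eq (hq : 2 < q) : convexityConst q = 8 / 2 ^ q * gradConst q := by
  rw [convexityConst, if_neg hq.ne', gradConst]

lemma convexityConst_nonneg (hq : 2 ≤ q) : 0 ≤ convexityConst q := by
  rcases hq.eq_or_lt with rfl | hq
  · rw [convexityConst_two]; exact zero_le_two
  · rw [convexityConst_eq hq]; exact mul_nonneg (by positivity) (gradConst_nonneg hq)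

lemma convexityConst_le_two (hq : 2 ≤ q) : convexityConst q ≤ 2 := by
  rcases hq.eq_or_lt with rfl | hq
  · exact convexityConst_two.le
  have hpow : (2 : ℝ) ^ (2 : ℝ) ≤ 2 ^ q :=
    Real.rpow_le_rpow_of_exponent_le one_le_two hq.le
  rw [Real.rpow_two] at hpow
  rw [convexityConst_eq hq]
  calc 8 / 2 ^ q * gradConst q ≤ 8 / 2 ^ 2 * 1 := by
        gcongr; exacts [gradConst_nonneg hq, gradConst_le_one hq]
    _ = 2 := by norm_num

lemma IsGlobalNPC.dist_geodPoint_rpow_le {M : Type*} [MetricSpace M] (hM : IsGlobalNPC M)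
    (hq : 2 ≤ q) {t : ℝ} (ht : t ∈ Icc (0 : ℝ) 1) (x y z : M) :
    dist z (geodPoint x t y) ^ q ≤ (1 - t) * dist z x ^ q + t * dist z y ^ q
      - convexityConst q / 2 * (t * (1 - t)) * dist x y ^ q := by
  have hcn := hM.isNPCPoint_geodPoint x y ht z
  rcases hq.eq_or_lt with rfl | hq
  · simp only [Real.rpow_two, convexityConst_two]
    linarith
  have htri := triangle_rpow_le hq ht (dist_nonneg (x := z) (y := x))
    (dist_nonneg (x := z) (y := y)) dist_nonneg
    (by rw [dist_comm z x, dist_comm z y]; exact abs_dist_sub_le x y z)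
    (dist_triangle_left x y z)
  have hpow := Real.rpow_le_rpow (sq_nonneg _) hcn (show 0 ≤ q / 2 by linarith)
  rw [← abs_rpow_eq_sq_rpow, abs_of_nonneg dist_nonneg] at hpow
  rw [convexityConst_eq hq]
  calc dist z (geodPoint x t y) ^ q
      ≤ (1 - t) * dist z x ^ q + t * dist z y ^ q
          - 4 / 2 ^ q * gradConst q * (t * (1 - t)) * dist x y ^ q := by linarith
    _ = _ := by ring

end Convexity

/-! ### Couplings and contractive barycentric maps -/

section Coupling

lemma HasFullSupport.map {X Y : Type*} [TopologicalSpace X] [MeasurableSpace X]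
    [TopologicalSpace Y] [MeasurableSpace Y] [OpensMeasurableSpace Y] {μ : Measure X}
    (hμ : HasFullSupport μ) {f : X → Y} (hf : Continuous f) (hfm : AEMeasurable f μ) :
    HasFullSupport (μ.map f) := by
  have hmeas : MeasurableSet ((μ.map f).support)ᶜ := Measure.isOpen_compl_support.measurableSet
  rw [HasFullSupport, Measure.map_apply_of_aemeasurable hfm hmeas]
  have hsub : μ.support ⊆ f ⁻¹' (μ.map f).support := fun x hx => by
    rw [Measure.mem_support_iff_forall] at hx
    exact (Measure.mem_support_iff_forall (f x)).2 fun U hU =>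
      (hx _ (hf.continuousAt.preimage_mem_nhds hU)).trans_le (Measure.le_map_apply hfm U)
  exact measure_mono_null (compl_subset_compl.2 hsub) hμ

variable {M : Type*} [MetricSpace M] [MeasurableSpace M] {p : ℝ}

lemma ContractiveBary.congr (β : ContractiveBary p M) {μ ν : ProbP p M} (h : μ.1 = ν.1) :
    β.1 μ = β.1 ν :=
  congrArg β.1 (Subtype.ext h)

lemma IsProbPMoment.lintegral_lt_top (hp : 1 ≤ p) {μ : Measure M} (hμ : IsProbPMoment p μ)
    (x : M) : ∫⁻ y, edist x y ^ p ∂μ < ∞ := by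
  have := hμ.isProb
  obtain ⟨x₀, hx₀⟩ := hμ.moment
  have htri : ∀ y, edist x y ^ p ≤ 2 ^ (p - 1) * (edist x x₀ ^ p + edist x₀ y ^ p) := fun y =>
    (ENNReal.rpow_le_rpow (edist_triangle x x₀ y) (by linarith)).trans
      (ENNReal.rpow_add_le_mul_rpow_add_rpow _ _ hp)
  refine (lintegral_mono htri).trans_lt ?_
  rw [lintegral_const_mul' _ _ (by finiteness), lintegral_add_left measurable_const,
    lintegral_const, measure_univ, mul_one]
  refine ENNReal.mul_lt_top (by finiteness) (ENNReal.add_lt_top.2 ⟨?_, hx₀⟩)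
  exact ENNReal.rpow_lt_top_of_nonneg (by linarith) (edist_ne_top _ _)

variable [BorelSpace M]

lemma map_prodMk_mem_couplings {X : Type*} [TopologicalSpace X] [MeasurableSpace X]
    [OpensMeasurableSpace X] {π : Measure X} [IsProbabilityMeasure π] (hπ : HasFullSupport π)
    {f g : X → M} (hf : Continuous f) (hg : Continuous g) :
    @Measure.map X (M × M) _ (borel (M × M)) (fun x => (f x, g x)) π ∈
      couplings (π.map f) (π.map g) := by
  let _ : MeasurableSpace (M × M) := borel (M × M)
  have : BorelSpace (M × M) := ⟨rfl⟩
  have hfg : Continuous fun x => (f x, g x) := hf.prodMk hg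
  refine ⟨Measure.isProbabilityMeasure_map hfg.measurable.aemeasurable,
    hπ.map hfg hfg.measurable.aemeasurable, fun B hB => ?_, fun B hB => ?_⟩
  · rw [prod_univ, Measure.map_apply hfg.measurable (continuous_fst.measurable hB),
      Measure.map_apply hf.measurable hB]
    rfl
  · rw [univ_prod, Measure.map_apply hfg.measurable (continuous_snd.measurable hB),
      Measure.map_apply hg.measurable hB]
    rfl

lemma wassersteinDist_map_le {X : Type*} [TopologicalSpace X] [MeasurableSpace X]
    [OpensMeasurableSpace X] (hp : 0 ≤ p) {π : Measure X} [IsProbabilityMeasure π]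
    (hπ : HasFullSupport π) {f g : X → M} (hf : Continuous f) (hg : Continuous g) :
    wassersteinDist p (π.map f) (π.map g) ≤ (∫⁻ x, edist (f x) (g x) ^ p ∂π) ^ (1 / p) := by
  let _ : MeasurableSpace (M × M) := borel (M × M)
  have : BorelSpace (M × M) := ⟨rfl⟩
  refine ENNReal.rpow_le_rpow ?_ (by positivity)
  refine (iInf₂_le _ (map_prodMk_mem_couplings hπ hf hg)).trans_eq ?_
  exact lintegral_map ((continuous_fst.edist continuous_snd).measurable.pow_const p)
    (hf.prodMk hg).measurable

lemma le_wassersteinDist.{u} {M : Type u} [MetricSpace M] [MeasurableSpace M] [BorelSpace M]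
    (hp : 0 < p) {μ ν : Measure M} {c : ℝ≥0∞}
    (h : ∀ (X : Type u) [TopologicalSpace X] [MeasurableSpace X] [BorelSpace X] (π : Measure X)
      [IsProbabilityMeasure π] (f g : X → M), HasFullSupport π → Continuous f → Continuous g →
      π.map f = μ → π.map g = ν → c ^ p ≤ ∫⁻ x, edist (f x) (g x) ^ p ∂π) :
    c ≤ wassersteinDist p μ ν := by
  let _ : MeasurableSpace (M × M) := borel (M × M)
  have : BorelSpace (M × M) := ⟨rfl⟩
  rw [wassersteinDist, one_div, ENNReal.le_rpow_inv_iff hp]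
  refine le_iInf₂ fun π ⟨_, hfull, hfst, hsnd⟩ => ?_
  refine h (M × M) π Prod.fst Prod.snd hfull continuous_fst continuous_snd ?_ ?_
  · ext B hB
    rw [Measure.map_apply continuous_fst.measurable hB, ← hfst B hB, prod_univ]
  · ext B hB
    rw [Measure.map_apply continuous_snd.measurable hB, ← hsnd B hB, univ_prod]

lemma ContractiveBary.edist_rpow_le {X : Type*} [TopologicalSpace X] [MeasurableSpace X]
    [OpensMeasurableSpace X] (hp : 0 < p) (β : ContractiveBary p M) {π : Measure X}
    [IsProbabilityMeasure π] (hπ : HasFullSupport π) {f g : X → M} (hf : Continuous f)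
    (hg : Continuous g) {μ ν : ProbP p M} (hμ : μ.1 = π.map f) (hν : ν.1 = π.map g) :
    edist (β.1 μ) (β.1 ν) ^ p ≤ ∫⁻ x, edist (f x) (g x) ^ p ∂π := by
  rw [← ENNReal.le_rpow_inv_iff hp, ← one_div]
  refine (β.2.contractive μ ν).trans ?_
  rw [hμ, hν]
  exact wassersteinDist_map_le hp.le hπ hf hg

lemma ContractiveBary.dist_le_of_forall_dist_le {X : Type*} [TopologicalSpace X]
    [MeasurableSpace X] [OpensMeasurableSpace X] (hp : 0 < p) (β : ContractiveBary p M)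
    {π : Measure X} [IsProbabilityMeasure π] (hπ : HasFullSupport π) {f g : X → M}
    (hf : Continuous f) (hg : Continuous g) {μ ν : ProbP p M} (hμ : μ.1 = π.map f)
    (hν : ν.1 = π.map g) {R : ℝ} (hR : ∀ x, dist (f x) (g x) ≤ R) :
    dist (β.1 μ) (β.1 ν) ≤ R := by
  obtain ⟨x₀⟩ := π.nonempty_of_neZero
  have hR0 : 0 ≤ R := dist_nonneg.trans (hR x₀)
  rw [← ENNReal.ofReal_le_ofReal_iff hR0, ← edist_dist, ← ENNReal.rpow_le_rpow_iff hp]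
  calc edist (β.1 μ) (β.1 ν) ^ p
      ≤ ∫⁻ x, edist (f x) (g x) ^ p ∂π := β.edist_rpow_le hp hπ hf hg hμ hν
    _ ≤ ∫⁻ _, ENNReal.ofReal R ^ p ∂π := lintegral_mono fun x => by
        rw [edist_dist]
        exact ENNReal.rpow_le_rpow (ENNReal.ofReal_le_ofReal (hR x)) hp.le
    _ = ENNReal.ofReal R ^ p := by rw [lintegral_const, measure_univ, mul_one]

end Coupling

/-! ### The flow -/

section Flow

variable {M : Type*} [MetricSpace M] {p : ℝ}

lemma IsGlobalNPC.edist_geodPoint_rpow_le (hM : IsGlobalNPC M) (hp : 1 ≤ p)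
    (x y a b : M) {t : ℝ} (ht : t ∈ Icc (0 : ℝ) 1) :
    edist (geodPoint x t a) (geodPoint y t b) ^ p ≤
      ENNReal.ofReal (1 - t) * edist x y ^ p + ENNReal.ofReal t * edist a b ^ p := by
  obtain ⟨ht0, ht1⟩ := ht
  have hp0 : 0 ≤ p := by linarith
  have ht1' : 0 ≤ 1 - t := by linarith
  simp only [edist_dist, ENNReal.ofReal_rpow_of_nonneg dist_nonneg hp0]
  rw [← ENNReal.ofReal_mul ht1', ← ENNReal.ofReal_mul ht0,
    ← ENNReal.ofReal_add (by positivity) (by positivity)]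
  refine ENNReal.ofReal_le_ofReal ?_
  calc dist (geodPoint x t a) (geodPoint y t b) ^ p
      ≤ ((1 - t) * dist x y + t * dist a b) ^ p :=
        Real.rpow_le_rpow dist_nonneg (hM.dist_geodPoint_le x y a b ⟨ht0, ht1⟩) hp0
    _ ≤ (1 - t) * dist x y ^ p + t * dist a b ^ p :=
        (convexOn_rpow hp).2 (mem_Ici.2 dist_nonneg) (mem_Ici.2 dist_nonneg) ht1' ht0 (by ring)

lemma le_of_le_convex_combination {a b : ℝ≥0∞} (ha : a ≠ ∞) {t : ℝ} (ht : t ∈ Ioc (0 : ℝ) 1)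
    (h : a ≤ ENNReal.ofReal (1 - t) * a + ENNReal.ofReal t * b) : a ≤ b := by
  have hsplit : a = ENNReal.ofReal (1 - t) * a + ENNReal.ofReal t * a := by
    rw [← add_mul, ← ENNReal.ofReal_add (by linarith [ht.2]) ht.1.le, sub_add_cancel,
      ENNReal.ofReal_one, one_mul]
  nth_rw 1 [hsplit] at h
  rw [ENNReal.add_le_add_iff_left (ENNReal.mul_ne_top ENNReal.ofReal_ne_top ha)] at h
  exact (ENNReal.mul_le_mul_iff_right (ENNReal.ofReal_pos.2 ht.1).ne' ENNReal.ofReal_ne_top).1 h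

variable [MeasurableSpace M] [BorelSpace M]

lemma IsGlobalNPC.isProbPMoment_geodMeasure (hM : IsGlobalNPC M) (hp : 1 ≤ p) (x : M)
    {t : ℝ} (ht : t ∈ Icc (0 : ℝ) 1) (μ : ProbP p M) :
    IsProbPMoment p (geodMeasure x t μ.1) := by
  have := μ.2.isProb
  have hgeod := hM.continuous_geodPoint x ht
  refine ⟨Measure.isProbabilityMeasure_map hgeod.measurable.aemeasurable,
    μ.2.fullSupport.map hgeod hgeod.measurable.aemeasurable, x, ?_⟩
  rw [geodMeasure, lintegral_map (measurable_edist_right.pow_const p) hgeod.measurable]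
  refine (lintegral_mono fun a => ENNReal.rpow_le_rpow ?_ (by linarith)).trans_lt
    (μ.2.lintegral_lt_top hp x)
  rw [edist_dist, edist_dist, hM.dist_left_geodPoint x a ht]
  exact ENNReal.ofReal_le_ofReal (mul_le_of_le_one_left dist_nonneg ht.2)

/-- The measure `x #_t μ` as an element of `𝒫^p(M)`. -/
noncomputable def IsGlobalNPC.geodP (hM : IsGlobalNPC M) (hp : 1 ≤ p) (x : M)
    (t : Ioc (0 : ℝ) 1) (μ : ProbP p M) : ProbP p M :=
  ⟨geodMeasure x t μ.1, hM.isProbPMoment_geodMeasure hp x (Ioc_subset_Icc_self t.2) μ⟩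

lemma IsGlobalNPC.dist_bary_geodP_le (hM : IsGlobalNPC M) (hp : 1 ≤ p)
    (β : ContractiveBary p M) (t : Ioc (0 : ℝ) 1) (μ : ProbP p M) (x y : M) :
    dist (β.1 (hM.geodP hp x t μ)) (β.1 (hM.geodP hp y t μ)) ≤ (1 - t) * dist x y := by
  have ht := Ioc_subset_Icc_self t.2
  have := μ.2.isProb
  exact β.dist_le_of_forall_dist_le (by linarith) μ.2.fullSupport (hM.continuous_geodPoint x ht)
    (hM.continuous_geodPoint y ht) rfl rfl fun a => by
      simpa using hM.dist_geodPoint_le x y a a ht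

lemma IsGlobalNPC.existsUnique_eq_bary_geodP (hM : IsGlobalNPC M) (hp : 1 ≤ p)
    (β : ContractiveBary p M) (t : Ioc (0 : ℝ) 1) (μ : ProbP p M) :
    ∃! x, x = β.1 (hM.geodP hp x t μ) := by
  have := hM.complete
  have : Nonempty M := ⟨μ.2.moment.choose⟩
  have hcontr : ContractingWith ⟨1 - t, sub_nonneg.2 t.2.2⟩
      fun x => β.1 (hM.geodP hp x t μ) :=
    ⟨sub_lt_self (1 : ℝ) t.2.1,
      LipschitzWith.of_dist_le_mul (hM.dist_bary_geodP_le hp β t μ)⟩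
  exact ⟨_, hcontr.fixedPoint_isFixedPt.symm,
    fun y hy => hcontr.fixedPoint_unique hy.symm⟩

/-- The fixed point of `x ↦ β(x #_t μ)`, which is the value of the flow `Φ_p(t, β)` at `μ`. -/
noncomputable def IsGlobalNPC.flowPoint (hM : IsGlobalNPC M) (hp : 1 ≤ p) (t : Ioc (0 : ℝ) 1)
    (β : ContractiveBary p M) (μ : ProbP p M) : M :=
  (hM.existsUnique_eq_bary_geodP hp β t μ).choose

lemma IsGlobalNPC.eq_flowPoint_iff (hM : IsGlobalNPC M) (hp : 1 ≤ p) (t : Ioc (0 : ℝ) 1)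
    (β : ContractiveBary p M) (μ : ProbP p M) (x : M) :
    x = hM.flowPoint hp t β μ ↔ x = β.1 (hM.geodP hp x t μ) := by
  obtain ⟨hfixed, hunique⟩ := (hM.existsUnique_eq_bary_geodP hp β t μ).choose_spec
  exact ⟨fun h => h ▸ hfixed, hunique x⟩

lemma IsGlobalNPC.flowPoint_dirac (hM : IsGlobalNPC M) (hp : 1 ≤ p) (t : Ioc (0 : ℝ) 1)
    (β : ContractiveBary p M) (x : M) (μ : ProbP p M) (hμ : μ.1 = Measure.dirac x) :
    hM.flowPoint hp t β μ = x := by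
  have ht := Ioc_subset_Icc_self t.2
  refine ((hM.eq_flowPoint_iff hp t β μ x).2 (β.2.map_dirac x _ ?_).symm).symm
  change geodMeasure x t μ.1 = _
  rw [hμ, geodMeasure, Measure.map_dirac' (hM.continuous_geodPoint x ht).measurable,
    ← hM.eq_geodPoint ht (v := x) (by simp) (by simp)]

lemma IsGlobalNPC.edist_flowPoint_le (hM : IsGlobalNPC M) (hp : 1 ≤ p) (t : Ioc (0 : ℝ) 1)
    (β : ContractiveBary p M) (μ ν : ProbP p M) :
    edist (hM.flowPoint hp t β μ) (hM.flowPoint hp t β ν) ≤ wassersteinDist p μ.1 ν.1 := by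
  have ht := Ioc_subset_Icc_self t.2
  have hp0 : 0 < p := by linarith
  refine le_wassersteinDist hp0 fun X _ _ _ π _ f g hπ hf hg hμ hν => ?_
  set x := hM.flowPoint hp t β μ with hx
  set y := hM.flowPoint hp t β ν with hy
  have hxgeod := hM.continuous_geodPoint x ht
  have hygeod := hM.continuous_geodPoint y ht
  refine le_of_le_convex_combination (ENNReal.rpow_ne_top_of_nonneg hp0.le (edist_ne_top x y))
    t.2 ?_
  calc edist x y ^ p
      = edist (β.1 (hM.geodP hp x t μ)) (β.1 (hM.geodP hp y t ν)) ^ p := by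
        rw [← (hM.eq_flowPoint_iff hp t β μ x).1 hx, ← (hM.eq_flowPoint_iff hp t β ν y).1 hy]
    _ ≤ ∫⁻ a, edist (geodPoint x t (f a)) (geodPoint y t (g a)) ^ p ∂π := by
        refine β.edist_rpow_le hp0 hπ (hxgeod.comp hf) (hygeod.comp hg) ?_ ?_
        · rw [← Measure.map_map hxgeod.measurable hf.measurable, hμ]; rfl
        · rw [← Measure.map_map hygeod.measurable hg.measurable, hν]; rfl
    _ ≤ ∫⁻ a, (ENNReal.ofReal (1 - t) * edist x y ^ p
          + ENNReal.ofReal t * edist (f a) (g a) ^ p) ∂π :=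
        lintegral_mono fun a => hM.edist_geodPoint_rpow_le hp x y (f a) (g a) ht
    _ = ENNReal.ofReal (1 - t) * edist x y ^ p
          + ENNReal.ofReal t * ∫⁻ a, edist (f a) (g a) ^ p ∂π := by
        rw [lintegral_add_left measurable_const, lintegral_const, measure_univ, mul_one,
          lintegral_const_mul' _ _ ENNReal.ofReal_ne_top]

/-- The semiflow `Φ_p(t, β)`. -/
noncomputable def IsGlobalNPC.flow (hM : IsGlobalNPC M) (hp : 1 ≤ p) (t : Ioc (0 : ℝ) 1)
    (β : ContractiveBary p M) : ContractiveBary p M :=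
  ⟨hM.flowPoint hp t β, hM.flowPoint_dirac hp t β, hM.edist_flowPoint_le hp t β⟩

lemma IsGlobalNPC.eq_flow_iff (hM : IsGlobalNPC M) (hp : 1 ≤ p) (t : Ioc (0 : ℝ) 1)
    (β : ContractiveBary p M) (μ : ProbP p M) (x : M) :
    x = (hM.flow hp t β).1 μ ↔ x = β.1 (hM.geodP hp x t μ) :=
  hM.eq_flowPoint_iff hp t β μ x

lemma IsGlobalNPC.flow_one (hM : IsGlobalNPC M) (hp : 1 ≤ p) (β : ContractiveBary p M) :
    hM.flow hp 1 β = β := by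
  refine Subtype.ext (funext fun μ => ((hM.eq_flow_iff hp 1 β μ _).2 (β.congr ?_)).symm)
  change μ.1 = geodMeasure _ 1 μ.1
  simp only [geodMeasure, hM.geodPoint_one, Measure.map_id']

lemma IsGlobalNPC.geodMeasure_geodMeasure (hM : IsGlobalNPC M) (x : M) {s t : ℝ}
    (hs : s ∈ Icc (0 : ℝ) 1) (ht : t ∈ Icc (0 : ℝ) 1) (μ : Measure M) :
    geodMeasure x s (geodMeasure x t μ) = geodMeasure x (t * s) μ := by
  rw [geodMeasure, geodMeasure, Measure.map_map (hM.continuous_geodPoint x hs).measurable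
    (hM.continuous_geodPoint x ht).measurable]
  exact congrArg (Measure.map · μ) (funext fun a => hM.geodPoint_geodPoint x a hs ht)

lemma IsGlobalNPC.flow_flow (hM : IsGlobalNPC M) (hp : 1 ≤ p) (s t : Ioc (0 : ℝ) 1)
    (β : ContractiveBary p M) : hM.flow hp t (hM.flow hp s β) = hM.flow hp (t * s) β := by
  refine Subtype.ext (funext fun μ => ?_)
  set x := (hM.flow hp (t * s) β).1 μ with hx
  have hgeod : hM.geodP hp x s (hM.geodP hp x t μ) = hM.geodP hp x (t * s) μ :=
    Subtype.ext (hM.geodMeasure_geodMeasure x (Ioc_subset_Icc_self s.2)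
      (Ioc_subset_Icc_self t.2) μ.1)
  rw [eq_comm, hM.eq_flow_iff, hM.eq_flow_iff, hgeod]
  exact (hM.eq_flow_iff hp (t * s) β μ x).1 hx

end Flow

/-! ### Uniform measures -/

section Uniform

open scoped BigOperators

variable {n : ℕ}

lemma isProbabilityMeasure_uniformOn {X : Type*} [MeasurableSpace X] (x : Fin (n + 1) → X) :
    IsProbabilityMeasure (uniformOn x) := by
  constructor
  simp only [uniformOn, Measure.smul_apply, Measure.finsetSum_apply, measure_univ,
    Finset.sum_const, Finset.card_univ, Fintype.card_fin, smul_eq_mul, nsmul_eq_mul, mul_one]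
  exact ENNReal.inv_mul_cancel (by simp) (ENNReal.natCast_ne_top _)

lemma map_uniformOn {X Y : Type*} [MeasurableSpace X] [MeasurableSpace Y] (x : Fin (n + 1) → X)
    {f : X → Y} (hf : Measurable f) : (uniformOn x).map f = uniformOn (f ∘ x) := by
  simp only [uniformOn, Measure.map_smul, Measure.map_finset_sum hf.aemeasurable,
    Measure.map_dirac' hf, Function.comp_apply]

lemma uniformOn_const {X : Type*} [MeasurableSpace X] (z : X) :
    uniformOn (fun _ : Fin (n + 1) => z) = Measure.dirac z := by
  rw [uniformOn, Finset.sum_const, Finset.card_univ, Fintype.card_fin,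
    ← Nat.cast_smul_eq_nsmul ℝ≥0∞, smul_smul,
    ENNReal.inv_mul_cancel (by simp) (ENNReal.natCast_ne_top _), one_smul]

lemma lintegral_uniformOn_ofReal {X : Type*} [MeasurableSpace X] (x : Fin (n + 1) → X)
    {f : X → ℝ} (hf : Measurable f) (hf0 : 0 ≤ f) :
    ∫⁻ a, ENNReal.ofReal (f a) ∂(uniformOn x) = ENNReal.ofReal (𝔼 j, f (x j)) := by
  simp only [uniformOn, lintegral_smul_measure, lintegral_finsetSum_measure,
    lintegral_dirac' _ hf.ennreal_ofReal, smul_eq_mul]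
  rw [← ENNReal.ofReal_sum_of_nonneg fun j _ => hf0 _, Fintype.expect_eq_sum_div_card,
    Fintype.card_fin, ENNReal.ofReal_div_of_pos (by positivity), ENNReal.ofReal_natCast, mul_comm,
    div_eq_mul_inv]

variable {M : Type*} [MetricSpace M]

lemma dist_le_diam_range (x : Fin (n + 1) → M) (i j : Fin (n + 1)) :
    dist (x i) (x j) ≤ Metric.diam (range x) :=
  Metric.dist_le_diam_of_mem (finite_range x).isBounded (mem_range_self i) (mem_range_self j)

variable [MeasurableSpace M] [BorelSpace M] {p : ℝ}

/-- The uniform measure on a finite family `𝐱` as an element of `𝒫^p(M)`. The value of `β` at it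
is what is denoted `β(𝐱)` in the definition of `d_p`. -/
noncomputable def uniformP (hp : 0 ≤ p) (x : Fin (n + 1) → M) : ProbP p M :=
  ⟨uniformOn x, uniformOn_isProbPMoment hp x⟩

namespace ContractiveBary

lemma uniformP_const (hp : 0 ≤ p) (β : ContractiveBary p M) (z : M) :
    β.1 (uniformP hp fun _ : Fin (n + 1) => z) = z :=
  β.2.map_dirac z _ (uniformOn_const z)

lemma dist_uniformP_rpow_le (hp : 0 < p) (β : ContractiveBary p M) (x y : Fin (n + 1) → M) :
    dist (β.1 (uniformP hp.le x)) (β.1 (uniformP hp.le y)) ^ p ≤ 𝔼 j, dist (x j) (y j) ^ p := by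
  have := isProbabilityMeasure_uniformOn (id : Fin (n + 1) → Fin (n + 1))
  have h := β.edist_rpow_le hp (π := uniformOn id) Measure.measure_compl_support
    (continuous_of_discreteTopology (f := x)) (continuous_of_discreteTopology (f := y))
    (μ := uniformP hp.le x) (ν := uniformP hp.le y)
    (map_uniformOn _ (measurable_of_countable x)).symm
    (map_uniformOn _ (measurable_of_countable y)).symm
  simp only [edist_dist, ENNReal.ofReal_rpow_of_nonneg dist_nonneg hp.le] at h
  rw [lintegral_uniformOn_ofReal _ (measurable_of_countable _) fun _ => by positivity] at h
  exact (ENNReal.ofReal_le_ofReal_iff (Finset.expect_nonneg fun _ _ => by positivity)).1 h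

lemma dist_uniformP_le (hp : 0 < p) (β : ContractiveBary p M) {x y : Fin (n + 1) → M} {R : ℝ}
    (hR : ∀ j, dist (x j) (y j) ≤ R) :
    dist (β.1 (uniformP hp.le x)) (β.1 (uniformP hp.le y)) ≤ R := by
  have hR0 : 0 ≤ R := dist_nonneg.trans (hR 0)
  refine (Real.rpow_le_rpow_iff dist_nonneg hR0 hp).1 ((β.dist_uniformP_rpow_le hp x y).trans ?_)
  exact Finset.expect_le Finset.univ_nonempty fun j _ =>
    Real.rpow_le_rpow dist_nonneg (hR j) hp.le

lemma dist_uniformP_le_diam (hp : 0 < p) (β : ContractiveBary p M) (x : Fin (n + 1) → M)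
    (i : Fin (n + 1)) : dist (β.1 (uniformP hp.le x)) (x i) ≤ Metric.diam (range x) := by
  have h := β.dist_uniformP_le hp (y := fun _ : Fin (n + 1) => x i)
    fun j => dist_le_diam_range x j i
  rwa [β.uniformP_const] at h

lemma edist_le_ofReal (hp : 0 ≤ p) {β₁ β₂ : ContractiveBary p M} {C : ℝ} (hC : 0 ≤ C)
    (h : ∀ (n : ℕ) (x : Fin (n + 1) → M),
      dist (β₁.1 (uniformP hp x)) (β₂.1 (uniformP hp x)) ≤ C * Metric.diam (range x)) :
    edist β₁ β₂ ≤ ENNReal.ofReal C := by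
  refine iSup_le fun n => iSup_le fun x => iSup_le fun _ => iSup_le fun _ => ?_
  refine ENNReal.div_le_of_le_mul ?_
  rw [← ENNReal.ofReal_mul hC, edist_dist]
  exact ENNReal.ofReal_le_ofReal (h n x)

lemma dist_le_toReal_edist_mul (hp : 0 < p) {β₁ β₂ : ContractiveBary p M} (h : edist β₁ β₂ ≠ ∞)
    (x : Fin (n + 1) → M) : dist (β₁.1 (uniformP hp.le x)) (β₂.1 (uniformP hp.le x)) ≤
      (edist β₁ β₂).toReal * Metric.diam (range x) := by
  rcases eq_or_ne (Metric.diam (range x)) 0 with hd | hd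
  · have h₁ := β₁.dist_uniformP_le_diam hp x 0
    have h₂ := β₂.dist_uniformP_le_diam hp x 0
    rw [hd] at h₁ h₂ ⊢
    linarith [dist_triangle_right (β₁.1 (uniformP hp.le x)) (β₂.1 (uniformP hp.le x)) (x 0)]
  · have hle : edist (β₁.1 (uniformP hp.le x)) (β₂.1 (uniformP hp.le x))
        / ENNReal.ofReal (Metric.diam (range x)) ≤ edist β₁ β₂ :=
      le_iSup_of_le n (le_iSup_of_le x (le_iSup_of_le (uniformP hp.le x).2
        (le_iSup_of_le hd le_rfl)))
    rw [ENNReal.div_le_iff (ENNReal.ofReal_pos.2 (Metric.diam_nonneg.lt_of_ne' hd)).ne'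
      ENNReal.ofReal_ne_top] at hle
    have := ENNReal.toReal_mono (ENNReal.mul_ne_top h ENNReal.ofReal_ne_top) hle
    rwa [ENNReal.toReal_mul, ENNReal.toReal_ofReal Metric.diam_nonneg, edist_dist,
      ENNReal.toReal_ofReal dist_nonneg] at this

end ContractiveBary

end Uniform

/-! ### The flow on uniform measures -/

section FlowUniform

open scoped BigOperators

variable {M : Type*} [MetricSpace M] {n : ℕ}

lemma IsGlobalNPC.diam_range_geodPoint_le (hM : IsGlobalNPC M) (y : M) {t : ℝ}
    (ht : t ∈ Icc (0 : ℝ) 1) (x : Fin (n + 1) → M) :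
    Metric.diam (range fun j => geodPoint y t (x j)) ≤ t * Metric.diam (range x) := by
  refine Metric.diam_le_of_forall_dist_le (mul_nonneg ht.1 Metric.diam_nonneg) ?_
  rintro _ ⟨i, rfl⟩ _ ⟨j, rfl⟩
  exact (hM.dist_geodPoint_right_le y _ _ ht).trans
    (mul_le_mul_of_nonneg_left (dist_le_diam_range x i j) ht.1)

variable [MeasurableSpace M] [BorelSpace M] {p : ℝ}

lemma IsGlobalNPC.flow_uniformP_eq (hM : IsGlobalNPC M) (hp : 1 ≤ p) (t : Ioc (0 : ℝ) 1)
    (β : ContractiveBary p M) (x : Fin (n + 1) → M) {y : M}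
    (hy : y = (hM.flow hp t β).1 (uniformP (zero_le_one.trans hp) x)) :
    y = β.1 (uniformP (zero_le_one.trans hp) fun j => geodPoint y t (x j)) :=
  ((hM.eq_flow_iff hp t β _ y).1 hy).trans (β.congr
    (map_uniformOn x (hM.continuous_geodPoint y (Ioc_subset_Icc_self t.2)).measurable))

lemma ContractiveBary.dist_uniformP_rpow_two_mul_le (hp : 0 < p) (β : ContractiveBary p M)
    (x : Fin (n + 1) → M) (z : M) :
    dist z (β.1 (uniformP hp.le x)) ^ (2 * p) ≤ 𝔼 j, dist z (x j) ^ (2 * p) := by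
  have hsq : ∀ a b : M, dist a b ^ (2 * p) = (dist a b ^ p) ^ 2 := fun a b => by
    rw [mul_comm, ← Real.rpow_mul_natCast dist_nonneg, Nat.cast_ofNat]
  have hle := β.dist_uniformP_rpow_le hp (fun _ : Fin (n + 1) => z) x
  rw [β.uniformP_const] at hle
  simp only [hsq]
  calc (dist z (β.1 (uniformP hp.le x)) ^ p) ^ 2 ≤ (𝔼 j, dist z (x j) ^ p) ^ 2 := by gcongr
    _ ≤ 𝔼 j, (dist z (x j) ^ p) ^ 2 := by
      simpa [Fintype.expect_const] using
        Finset.expect_mul_sq_le_sq_mul_sq Finset.univ (fun j => dist z (x j) ^ p) fun _ => 1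

/-- The variance inequality for `Φ_p(s, β)`. -/
lemma IsGlobalNPC.dist_flow_uniformP_rpow_le (hM : IsGlobalNPC M) (hp : 1 ≤ p)
    (s : Ioc (0 : ℝ) 1) (β : ContractiveBary p M) (x : Fin (n + 1) → M) (z : M) {y : M}
    (hy : y = (hM.flow hp s β).1 (uniformP (zero_le_one.trans hp) x)) :
    dist z y ^ (2 * p) ≤ 𝔼 j, dist z (x j) ^ (2 * p)
      - convexityConst (2 * p) / 2 * (1 - s) * 𝔼 j, dist y (x j) ^ (2 * p) := by
  set k := convexityConst (2 * p)
  have hbary : dist z y ^ (2 * p) ≤ 𝔼 j, dist z (geodPoint y s (x j)) ^ (2 * p) := by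
    have h := β.dist_uniformP_rpow_two_mul_le (zero_lt_one.trans_le hp)
      (fun j => geodPoint y s (x j)) z
    rwa [← hM.flow_uniformP_eq hp s β x hy] at h
  have hconvex : 𝔼 j, dist z (geodPoint y s (x j)) ^ (2 * p) ≤
      𝔼 j, ((1 - s) * dist z y ^ (2 * p) + s * dist z (x j) ^ (2 * p)
        - k / 2 * (s * (1 - s)) * dist y (x j) ^ (2 * p)) :=
    Finset.expect_le_expect fun j _ =>
      hM.dist_geodPoint_rpow_le (by linarith) (Ioc_subset_Icc_self s.2) y (x j) z
  rw [Finset.expect_sub_distrib, Finset.expect_add_distrib, Fintype.expect_const,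
    ← Finset.mul_expect, ← Finset.mul_expect] at hconvex
  refine le_of_mul_le_mul_left ?_ s.2.1
  linarith

lemma ContractiveBary.expect_dist_rpow_le_diam_rpow (hp : 0 < p) {q : ℝ} (hq : 0 ≤ q)
    (β : ContractiveBary p M) (x : Fin (n + 1) → M) :
    𝔼 j, dist (β.1 (uniformP hp.le x)) (x j) ^ q ≤ Metric.diam (range x) ^ q :=
  Finset.expect_le Finset.univ_nonempty fun j _ =>
    Real.rpow_le_rpow dist_nonneg (β.dist_uniformP_le_diam hp x j) hq

lemma IsGlobalNPC.dist_flow_flow_rpow_le (hM : IsGlobalNPC M) (hp : 1 ≤ p)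
    (t s : Ioc (0 : ℝ) 1) (β : ContractiveBary p M) (x : Fin (n + 1) → M) :
    dist ((hM.flow hp t β).1 (uniformP (zero_le_one.trans hp) x))
        ((hM.flow hp s β).1 (uniformP (zero_le_one.trans hp) x)) ^ (2 * p) ≤
      (convexityConst (2 * p) * ((s : ℝ) + t) + 2 * (2 - convexityConst (2 * p))) / 4
        * Metric.diam (range x) ^ (2 * p) := by
  have hp0 : 0 < p := by linarith
  have hk0 := convexityConst_nonneg (show 2 ≤ 2 * p by linarith)
  have hk2 := convexityConst_le_two (show 2 ≤ 2 * p by linarith)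
  set k := convexityConst (2 * p)
  set u := (hM.flow hp t β).1 (uniformP (zero_le_one.trans hp) x) with hu
  set v := (hM.flow hp s β).1 (uniformP (zero_le_one.trans hp) x) with hv
  set Δ := Metric.diam (range x)
  have huv := hM.dist_flow_uniformP_rpow_le hp s β x u hv
  have hvu := hM.dist_flow_uniformP_rpow_le hp t β x v hu
  rw [dist_comm v u] at hvu
  have hudiam : 𝔼 j, dist u (x j) ^ (2 * p) ≤ Δ ^ (2 * p) :=
    (hM.flow hp t β).expect_dist_rpow_le_diam_rpow hp0 (by positivity) x
  have hvdiam : 𝔼 j, dist v (x j) ^ (2 * p) ≤ Δ ^ (2 * p) :=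
    (hM.flow hp s β).expect_dist_rpow_le_diam_rpow hp0 (by positivity) x
  have hcoeff : ∀ r : Ioc (0 : ℝ) 1, 0 ≤ 1 - k / 2 * (1 - r) := fun r => by
    nlinarith [r.2.1, r.2.2]
  linarith [mul_le_mul_of_nonneg_left hudiam (hcoeff t),
    mul_le_mul_of_nonneg_left hvdiam (hcoeff s)]

lemma IsGlobalNPC.edist_flow_flow_le (hM : IsGlobalNPC M) (hp : 1 ≤ p) (t s : Ioc (0 : ℝ) 1)
    (β : ContractiveBary p M) :
    edist (hM.flow hp t β) (hM.flow hp s β) ≤ ENNReal.ofReal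
      (((convexityConst (2 * p) * ((s : ℝ) + t) + 2 * (2 - convexityConst (2 * p))) / 4)
        ^ (1 / (2 * p))) := by
  have hq : 0 < 2 * p := by linarith
  have hE : 0 ≤
      (convexityConst (2 * p) * ((s : ℝ) + t) + 2 * (2 - convexityConst (2 * p))) / 4 := by
    have hk2 := convexityConst_le_two (show 2 ≤ 2 * p by linarith)
    have := mul_nonneg (convexityConst_nonneg (show 2 ≤ 2 * p by linarith))
      (add_nonneg s.2.1.le t.2.1.le)
    linarith
  refine ContractiveBary.edist_le_ofReal (zero_le_one.trans hp) (by positivity) fun n x => ?_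
  refine (Real.rpow_le_rpow_iff dist_nonneg
    (mul_nonneg (by positivity) Metric.diam_nonneg) hq).1 ?_
  rw [Real.mul_rpow (by positivity) Metric.diam_nonneg, ← Real.rpow_mul hE,
    one_div_mul_cancel hq.ne', Real.rpow_one]
  exact hM.dist_flow_flow_rpow_le hp t s β x

lemma IsGlobalNPC.edist_flow_le (hM : IsGlobalNPC M) (hp : 1 ≤ p) (t : Ioc (0 : ℝ) 1)
    (β β' : ContractiveBary p M) :
    edist (hM.flow hp t β) (hM.flow hp t β') ≤ edist β β' := by
  have hp0 : 0 < p := by linarith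
  have ht := Ioc_subset_Icc_self t.2
  rcases eq_or_ne (edist β β') ∞ with htop | htop
  · rw [htop]; exact le_top
  rw [← ENNReal.ofReal_toReal htop]
  refine ContractiveBary.edist_le_ofReal hp0.le ENNReal.toReal_nonneg fun n x => ?_
  set u := (hM.flow hp t β).1 (uniformP (zero_le_one.trans hp) x) with hu
  set v := (hM.flow hp t β').1 (uniformP (zero_le_one.trans hp) x) with hv
  set w := β.1 (uniformP (zero_le_one.trans hp) fun j => geodPoint v t (x j))
  have huw : dist u w ≤ (1 - t) * dist u v := by
    have hle := β.dist_uniformP_le hp0 (x := fun j => geodPoint u t (x j))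
      (y := fun j => geodPoint v t (x j)) fun j => by
        simpa using hM.dist_geodPoint_le u v (x j) (x j) ht
    rwa [← hM.flow_uniformP_eq hp t β x hu] at hle
  have hwv : dist w v ≤ (edist β β').toReal * (t * Metric.diam (range x)) := by
    have hle := ContractiveBary.dist_le_toReal_edist_mul hp0 htop fun j => geodPoint v t (x j)
    rw [← hM.flow_uniformP_eq hp t β' x hv] at hle
    exact hle.trans
      (mul_le_mul_of_nonneg_left (hM.diam_range_geodPoint_le v ht x) ENNReal.toReal_nonneg)
  refine le_of_mul_le_mul_left ?_ t.2.1
  linarith [dist_triangle u w v]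

lemma IsGlobalNPC.edist_flow_flow_le_abs_sub_div (hM : IsGlobalNPC M) (hp : 1 ≤ p)
    (t s : Ioc (0 : ℝ) 1) (β : ContractiveBary p M) :
    edist (hM.flow hp t β) (hM.flow hp s β) ≤ ENNReal.ofReal (|(t : ℝ) - s| / t) := by
  have hp0 : 0 < p := by linarith
  have ht := Ioc_subset_Icc_self t.2
  have hs := Ioc_subset_Icc_self s.2
  refine ContractiveBary.edist_le_ofReal hp0.le (div_nonneg (abs_nonneg _) ht.1) fun n x => ?_
  have hdiam := (hM.flow hp s β).dist_uniformP_le_diam hp0 x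
  set u := (hM.flow hp t β).1 (uniformP (zero_le_one.trans hp) x) with hu
  set v := (hM.flow hp s β).1 (uniformP (zero_le_one.trans hp) x) with hv
  have hpoint : ∀ j, dist (geodPoint u t (x j)) (geodPoint v s (x j)) ≤
      (1 - t) * dist u v + |(t : ℝ) - s| * Metric.diam (range x) := fun j =>
    calc dist (geodPoint u t (x j)) (geodPoint v s (x j))
        ≤ dist (geodPoint u t (x j)) (geodPoint v t (x j))
            + dist (geodPoint v t (x j)) (geodPoint v s (x j)) := dist_triangle _ _ _
      _ ≤ (1 - t) * dist u v + |(t : ℝ) - s| * Metric.diam (range x) := by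
          refine add_le_add (by simpa using hM.dist_geodPoint_le u v (x j) (x j) ht) ?_
          rw [hM.dist_geodPoint_geodPoint v (x j) ht hs]
          exact mul_le_mul_of_nonneg_left (hdiam j) (abs_nonneg _)
  have huv := β.dist_uniformP_le hp0 hpoint
  rw [← hM.flow_uniformP_eq hp t β x hu, ← hM.flow_uniformP_eq hp s β x hv] at huv
  rw [div_mul_eq_mul_div, le_div_iff₀ t.2.1]
  linarith

lemma IsGlobalNPC.continuous_flow (hM : IsGlobalNPC M) (hp : 1 ≤ p) :
    Continuous fun a : Ioc (0 : ℝ) 1 × ContractiveBary p M => hM.flow hp a.1 a.2 := by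
  refine continuous_iff_continuousAt.2 fun ⟨t, β⟩ => ?_
  rw [ContinuousAt, tendsto_iff_edist_tendsto_0]
  have hbound : ∀ a : Ioc (0 : ℝ) 1 × ContractiveBary p M,
      edist (hM.flow hp a.1 a.2) (hM.flow hp t β) ≤
        edist a.2 β + ENNReal.ofReal (|(t : ℝ) - a.1| / t) := fun a => by
    refine (edist_triangle _ (hM.flow hp a.1 β) _).trans
      (add_le_add (hM.edist_flow_le hp a.1 a.2 β) ?_)
    rw [edist_comm]
    exact hM.edist_flow_flow_le_abs_sub_div hp t a.1 β
  have hcont : Continuous fun a : Ioc (0 : ℝ) 1 × ContractiveBary p M =>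
      edist a.2 β + ENNReal.ofReal (|(t : ℝ) - a.1| / t) :=
    (continuous_snd.edist continuous_const).add (ENNReal.continuous_ofReal.comp (by fun_prop))
  refine tendsto_of_tendsto_of_tendsto_of_le_of_le tendsto_const_nhds ?_ (fun _ => zero_le) hbound
  simpa using hcont.tendsto (t, β)

end FlowUniform

/-! ### The canonical barycentric map -/

section StronglyGeodConvex

variable {M : Type*} [MetricSpace M]

/-- Strong convexity of `F` along geodesics, with the modulus of the functions `dist z · ^ 2`. It
yields existence of minimizers and quadratic growth away from them. -/
def StronglyGeodConvex (F : M → ℝ) : Prop :=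
  ∀ x y : M, ∀ t ∈ Icc (0 : ℝ) 1,
    F (geodPoint x t y) ≤ (1 - t) * F x + t * F y - t * (1 - t) * dist x y ^ 2

lemma StronglyGeodConvex.exists_forall_le [CompleteSpace M] [Nonempty M] {F : M → ℝ}
    (hF : StronglyGeodConvex F) (hcont : Continuous F) (hbdd : BddBelow (range F)) :
    ∃ b, ∀ z, F b ≤ F z := by
  obtain ⟨u, hanti, hlim, hmem⟩ := exists_seq_tendsto_sInf (range_nonempty F) hbdd
  choose z hz using hmem
  set I := sInf (range F)
  have hI : ∀ y, I ≤ F y := fun y => csInf_le hbdd (mem_range_self y)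
  have hdist : ∀ n m N, N ≤ n → N ≤ m → dist (z n) (z m) ≤ √(4 * (u N - I)) :=
    fun n m N hn hm => Real.le_sqrt_of_sq_le (by
      have hmid := hF (z n) (z m) (1 / 2) (by norm_num)
      linarith [hI (geodPoint (z n) (1 / 2) (z m)), hz n, hz m, hanti hn, hanti hm])
  have hcauchy : CauchySeq z := by
    refine cauchySeq_of_le_tendsto_0 _ hdist ?_
    simpa using ((hlim.sub_const I).const_mul 4).sqrt
  obtain ⟨b, hb⟩ := cauchySeq_tendsto_of_complete hcauchy
  have hFb : F b = I :=
    tendsto_nhds_unique ((hcont.tendsto b).comp hb) (hlim.congr fun n => (hz n).symm)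
  exact ⟨b, fun y => hFb.trans_le (hI y)⟩

lemma StronglyGeodConvex.add_dist_sq_le {F : M → ℝ} (hF : StronglyGeodConvex F) {b : M}
    (hb : ∀ z, F b ≤ F z) (z : M) : F b + dist z b ^ 2 ≤ F z := by
  have hle : ∀ t ∈ Ioo (0 : ℝ) 1, F b + (1 - t) * dist z b ^ 2 ≤ F z := fun t ht => by
    have hgeod := (hb _).trans (hF b z t (Ioo_subset_Icc_self ht))
    rw [dist_comm b z] at hgeod
    refine le_of_mul_le_mul_left ?_ ht.1
    linarith
  have hlim : Tendsto (fun t : ℝ => F b + (1 - t) * dist z b ^ 2) (𝓝[>] 0)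
      (𝓝 (F b + (1 - 0) * dist z b ^ 2)) :=
    (Continuous.tendsto (by fun_prop) 0).mono_left nhdsWithin_le_nhds
  rw [sub_zero, one_mul] at hlim
  exact le_of_tendsto hlim (by filter_upwards [Ioo_mem_nhdsGT one_pos] using hle)

end StronglyGeodConvex

section RelVariance

lemma abs_dist_sq_sub_dist_sq_le {X : Type*} [PseudoMetricSpace X] (z w a : X) :
    |dist z a ^ 2 - dist w a ^ 2| ≤ dist z w * (2 * dist w a + dist z w) := by
  rw [sq_sub_sq, abs_mul, mul_comm, abs_of_nonneg (by positivity : 0 ≤ dist z a + dist w a)]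
  refine mul_le_mul (abs_dist_sub_le z w a) ?_ (by positivity) dist_nonneg
  linarith [dist_triangle z w a]

lemma dist_sq_sub_le_dist_sq_sub {X : Type*} [PseudoMetricSpace X] (z w a : X) :
    dist z w ^ 2 - 2 * dist z w * dist w a ≤ dist z a ^ 2 - dist w a ^ 2 := by
  have hsq := pow_le_pow_left₀ (abs_nonneg _) (abs_dist_sub_le z a w) 2
  rw [sq_abs, dist_comm a w] at hsq
  linarith

variable {M : Type*} [MetricSpace M] [MeasurableSpace M]

/-- The functional `∫ [d(z,a)² - d(w,a)²] dμ(a)`, whose minimizer in `z`, for any `w`, is the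
barycenter of `μ`. -/
noncomputable def relVariance (μ : Measure M) (z w : M) : ℝ :=
  ∫ a, (dist z a ^ 2 - dist w a ^ 2) ∂μ

variable [BorelSpace M]

namespace ProbP

lemma integrable_dist (μ : ProbP 1 M) (z : M) : Integrable (fun a => dist z a) μ.1 := by
  refine ⟨(continuous_const.dist continuous_id).measurable.aestronglyMeasurable, ?_⟩
  simpa [HasFiniteIntegral, edist_dist, Real.enorm_eq_ofReal] using
    μ.2.lintegral_lt_top le_rfl z

lemma integrable_dist_sq_sub (μ : ProbP 1 M) (z w : M) :
    Integrable (fun a => dist z a ^ 2 - dist w a ^ 2) μ.1 := by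
  have := μ.2.isProb
  have hcont : Continuous fun a => dist z a ^ 2 - dist w a ^ 2 := by fun_prop
  have hbound : Integrable (fun a => dist z w * (2 * dist w a + dist z w)) μ.1 :=
    (((μ.integrable_dist w).const_mul 2).add (integrable_const _)).const_mul _
  exact hbound.mono' hcont.measurable.aestronglyMeasurable
    (.of_forall (abs_dist_sq_sub_dist_sq_le z w))

lemma relVariance_add (μ : ProbP 1 M) (z w y : M) :
    relVariance μ.1 z w + relVariance μ.1 w y = relVariance μ.1 z y := by
  rw [relVariance, relVariance, ← integral_add (μ.integrable_dist_sq_sub z w)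
    (μ.integrable_dist_sq_sub w y)]
  simp only [sub_add_sub_cancel, relVariance]

lemma abs_relVariance_le (μ : ProbP 1 M) (z w : M) :
    |relVariance μ.1 z w| ≤ dist z w * (2 * ∫ a, dist w a ∂μ.1 + dist z w) := by
  have := μ.2.isProb
  have hint := (μ.integrable_dist w).const_mul 2
  calc |relVariance μ.1 z w|
      ≤ ∫ a, |dist z a ^ 2 - dist w a ^ 2| ∂μ.1 := abs_integral_le_integral_abs
    _ ≤ ∫ a, dist z w * (2 * dist w a + dist z w) ∂μ.1 :=
        integral_mono (μ.integrable_dist_sq_sub z w).abs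
          ((hint.add (integrable_const _)).const_mul _) (abs_dist_sq_sub_dist_sq_le z w)
    _ = dist z w * (2 * ∫ a, dist w a ∂μ.1 + dist z w) := by
        rw [integral_const_mul, integral_add hint (integrable_const _), integral_const_mul,
          integral_const, probReal_univ, one_smul]

lemma continuous_relVariance (μ : ProbP 1 M) (w : M) :
    Continuous fun z => relVariance μ.1 z w := by
  refine continuous_iff_continuousAt.2 fun y => tendsto_iff_dist_tendsto_zero.2 ?_
  refine squeeze_zero (g := fun z => dist z y * (2 * ∫ a, dist y a ∂μ.1 + dist z y))
    (fun _ => dist_nonneg) (fun z => ?_) ?_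
  · rw [Real.dist_eq, ← μ.relVariance_add z y w, add_sub_cancel_right]
    exact μ.abs_relVariance_le z y
  · exact Continuous.tendsto' (by fun_prop) y 0 (by simp)

lemma le_relVariance (μ : ProbP 1 M) (z w : M) :
    dist z w ^ 2 - 2 * dist z w * ∫ a, dist w a ∂μ.1 ≤ relVariance μ.1 z w := by
  have := μ.2.isProb
  have hint := (μ.integrable_dist w).const_mul (2 * dist z w)
  calc dist z w ^ 2 - 2 * dist z w * ∫ a, dist w a ∂μ.1
      = ∫ a, (dist z w ^ 2 - 2 * dist z w * dist w a) ∂μ.1 := by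
        rw [integral_sub (integrable_const _) hint, integral_const_mul, integral_const,
          probReal_univ, one_smul]
    _ ≤ relVariance μ.1 z w :=
        integral_mono ((integrable_const _).sub hint) (μ.integrable_dist_sq_sub z w)
          (dist_sq_sub_le_dist_sq_sub z w)

lemma bddBelow_range_relVariance (μ : ProbP 1 M) (w : M) :
    BddBelow (range fun z => relVariance μ.1 z w) := by
  refine ⟨-(∫ a, dist w a ∂μ.1) ^ 2, forall_mem_range.2 fun z => ?_⟩
  linarith [μ.le_relVariance z w, sq_nonneg (dist z w - ∫ a, dist w a ∂μ.1)]

end ProbP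

lemma IsGlobalNPC.stronglyGeodConvex_relVariance (hM : IsGlobalNPC M) (μ : ProbP 1 M) (w : M) :
    StronglyGeodConvex fun z => relVariance μ.1 z w := by
  intro x y t ht
  have := μ.2.isProb
  have hx := (μ.integrable_dist_sq_sub x w).const_mul (1 - t)
  have hy := (μ.integrable_dist_sq_sub y w).const_mul t
  have hsum : Integrable (fun a => (1 - t) * (dist x a ^ 2 - dist w a ^ 2)
      + t * (dist y a ^ 2 - dist w a ^ 2)) μ.1 := hx.add hy
  have hconst := integrable_const (μ := μ.1) (t * (1 - t) * dist x y ^ 2)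
  calc relVariance μ.1 (geodPoint x t y) w
      ≤ ∫ a, ((1 - t) * (dist x a ^ 2 - dist w a ^ 2) + t * (dist y a ^ 2 - dist w a ^ 2)
          - t * (1 - t) * dist x y ^ 2) ∂μ.1 := by
        refine integral_mono (μ.integrable_dist_sq_sub _ w) (hsum.sub hconst) fun a => ?_
        have hgeod := hM.isNPCPoint_geodPoint x y ht a
        rw [dist_comm a, dist_comm a x, dist_comm a y] at hgeod
        dsimp only
        linarith
    _ = (1 - t) * relVariance μ.1 x w + t * relVariance μ.1 y w
          - t * (1 - t) * dist x y ^ 2 := by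
        rw [integral_sub hsum hconst, integral_add hx hy, integral_const_mul,
          integral_const_mul, integral_const, probReal_univ, one_smul, relVariance, relVariance]

lemma IsGlobalNPC.exists_dist_sq_le_relVariance (hM : IsGlobalNPC M) (μ : ProbP 1 M) :
    ∃ b, ∀ z, dist z b ^ 2 ≤ relVariance μ.1 z b := by
  have := hM.complete
  obtain ⟨w, -⟩ := μ.2.moment
  have : Nonempty M := ⟨w⟩
  have hconvex := hM.stronglyGeodConvex_relVariance μ w
  obtain ⟨b, hb⟩ := hconvex.exists_forall_le (μ.continuous_relVariance w)
    (μ.bddBelow_range_relVariance w)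
  exact ⟨b, fun z => by linarith [hconvex.add_dist_sq_le hb z, μ.relVariance_add z b w]⟩

end RelVariance

section Barycenter

open scoped BigOperators

variable {M : Type*} [MetricSpace M] [MeasurableSpace M] [BorelSpace M]

/-- The barycenter `λ(μ)`, characterized by the variance inequality
`d(z,λ(μ))² ≤ ∫ [d(z,a)² - d(λ(μ),a)²] dμ(a)`. -/
noncomputable def IsGlobalNPC.barycenter (hM : IsGlobalNPC M) (μ : ProbP 1 M) : M :=
  (hM.exists_dist_sq_le_relVariance μ).choose

lemma IsGlobalNPC.dist_barycenter_sq_le (hM : IsGlobalNPC M) (μ : ProbP 1 M) (z : M) :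
    dist z (hM.barycenter μ) ^ 2 ≤ relVariance μ.1 z (hM.barycenter μ) :=
  (hM.exists_dist_sq_le_relVariance μ).choose_spec z

lemma IsGlobalNPC.barycenter_dirac (hM : IsGlobalNPC M) (x : M) (μ : ProbP 1 M)
    (hμ : μ.1 = Measure.dirac x) : hM.barycenter μ = x := by
  have hle := hM.dist_barycenter_sq_le μ x
  set b := hM.barycenter μ
  have hcont : Continuous fun a => dist x a ^ 2 - dist b a ^ 2 := by fun_prop
  rw [relVariance, hμ, integral_dirac' _ _ hcont.measurable.stronglyMeasurable, dist_self,
    dist_comm b x] at hle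
  have hzero : dist x b ^ 2 = 0 := by nlinarith [sq_nonneg (dist x b)]
  exact (dist_eq_zero.1 (pow_eq_zero_iff two_ne_zero |>.1 hzero)).symm

variable {X : Type*} [MeasurableSpace X] {π : Measure X} {f g : X → M}

lemma IsGlobalNPC.relVariance_add_relVariance_le (hM : IsGlobalNPC M) (hf : Measurable f)
    (hg : Measurable g) (hint : Integrable (fun x => dist (f x) (g x)) π) {μ ν : ProbP 1 M}
    (hμ : π.map f = μ.1) (hν : π.map g = ν.1) (a b : M) :
    relVariance μ.1 b a + relVariance ν.1 a b ≤ 2 * dist a b * ∫ x, dist (f x) (g x) ∂π := by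
  have hμint := μ.integrable_dist_sq_sub b a
  have hνint := ν.integrable_dist_sq_sub a b
  rw [← hμ] at hμint
  rw [← hν] at hνint
  have hfint : Integrable (fun x => dist b (f x) ^ 2 - dist a (f x) ^ 2) π :=
    hμint.comp_measurable hf
  have hgint : Integrable (fun x => dist a (g x) ^ 2 - dist b (g x) ^ 2) π :=
    hνint.comp_measurable hg
  rw [relVariance, relVariance, ← hμ, ← hν, integral_map hf.aemeasurable hμint.1,
    integral_map hg.aemeasurable hνint.1, ← integral_add hfint hgint, ← integral_const_mul]
  refine integral_mono (hfint.add hgint) (hint.const_mul _) fun x => ?_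
  have hquad := hM.dist_sq_add_dist_sq_le b a (f x) (g x)
  rw [dist_comm b a] at hquad
  dsimp only
  linarith

lemma IsGlobalNPC.dist_barycenter_le_integral (hM : IsGlobalNPC M) (hf : Measurable f)
    (hg : Measurable g) (hint : Integrable (fun x => dist (f x) (g x)) π) {μ ν : ProbP 1 M}
    (hμ : π.map f = μ.1) (hν : π.map g = ν.1) :
    dist (hM.barycenter μ) (hM.barycenter ν) ≤ ∫ x, dist (f x) (g x) ∂π := by
  set a := hM.barycenter μ
  set b := hM.barycenter ν
  rcases (dist_nonneg (x := a) (y := b)).eq_or_lt with hab | hab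
  · rw [← hab]
    exact integral_nonneg fun _ => dist_nonneg
  · have hba := hM.dist_barycenter_sq_le μ b
    rw [dist_comm b] at hba
    refine le_of_mul_le_mul_left ?_ (mul_pos two_pos hab)
    linarith [hM.dist_barycenter_sq_le ν a,
      hM.relVariance_add_relVariance_le hf hg hint hμ hν a b]

lemma IsGlobalNPC.edist_barycenter_le (hM : IsGlobalNPC M) (μ ν : ProbP 1 M) :
    edist (hM.barycenter μ) (hM.barycenter ν) ≤ wassersteinDist 1 μ.1 ν.1 := by
  refine le_wassersteinDist one_pos fun X _ _ _ π _ f g _ hf hg hμ hν => ?_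
  simp only [ENNReal.rpow_one]
  rcases eq_or_ne (∫⁻ x, edist (f x) (g x) ∂π) ∞ with htop | htop
  · rw [htop]; exact le_top
  have hint : Integrable (fun x => dist (f x) (g x)) π := by
    refine ⟨(hf.dist hg).measurable.aestronglyMeasurable, ?_⟩
    simpa [HasFiniteIntegral, edist_dist, Real.enorm_eq_ofReal, lt_top_iff_ne_top] using htop
  simp only [edist_dist]
  rw [← ofReal_integral_eq_lintegral_ofReal hint (.of_forall fun _ => dist_nonneg)]
  exact ENNReal.ofReal_le_ofReal
    (hM.dist_barycenter_le_integral hf.measurable hg.measurable hint hμ hν)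

/-- The canonical barycentric map `λ ∈ 𝒞_1(M)`. -/
noncomputable def IsGlobalNPC.canonicalBary (hM : IsGlobalNPC M) : ContractiveBary 1 M :=
  ⟨hM.barycenter, hM.barycenter_dirac, hM.edist_barycenter_le⟩

lemma IsGlobalNPC.isCanonical_canonicalBary (hM : IsGlobalNPC M) :
    IsCanonicalBarycentricMap hM.canonicalBary := by
  intro μ y z hz
  have hpos : 0 < dist z (hM.barycenter μ) ^ 2 := pow_pos (dist_pos.2 hz) 2
  change relVariance μ.1 (hM.barycenter μ) y < relVariance μ.1 z y
  linarith [hM.dist_barycenter_sq_le μ z, μ.relVariance_add z (hM.barycenter μ) y]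

lemma integral_uniformOn {n : ℕ} (x : Fin (n + 1) → X) {φ : X → ℝ} (hφ : Measurable φ) :
    ∫ a, φ a ∂(uniformOn x) = 𝔼 j, φ (x j) := by
  rw [uniformOn, integral_smul_measure, integral_finsetSum_measure fun j _ =>
    integrable_dirac' hφ.stronglyMeasurable (by finiteness), Fintype.expect_eq_sum_div_card]
  simp only [integral_dirac' _ _ hφ.stronglyMeasurable, smul_eq_mul, ENNReal.toReal_inv,
    ENNReal.toReal_natCast, Fintype.card_fin, inv_mul_eq_div]

lemma IsGlobalNPC.edist_flow_canonicalBary_le (hM : IsGlobalNPC M) (t : Ioc (0 : ℝ) 1)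
    (β : ContractiveBary 1 M) :
    edist (hM.flow le_rfl t β) hM.canonicalBary ≤ ENNReal.ofReal √(t : ℝ) := by
  refine ContractiveBary.edist_le_ofReal zero_le_one (Real.sqrt_nonneg _) fun n x => ?_
  set u := (hM.flow le_rfl t β).1 (uniformP zero_le_one x) with hu
  set b := hM.canonicalBary.1 (uniformP zero_le_one x)
  set Δ := Metric.diam (range x)
  have hflow := hM.dist_flow_uniformP_rpow_le le_rfl t β x b hu
  have hbary : dist u b ^ 2 ≤ ∫ a, (dist u a ^ 2 - dist b a ^ 2) ∂(uniformOn x) :=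
    hM.dist_barycenter_sq_le (uniformP zero_le_one x) u
  have hcont : Continuous fun a => dist u a ^ 2 - dist b a ^ 2 := by fun_prop
  have hdiam : 𝔼 j, dist u (x j) ^ (2 : ℝ) ≤ Δ ^ (2 : ℝ) :=
    (hM.flow le_rfl t β).expect_dist_rpow_le_diam_rpow one_pos zero_le_two x
  rw [integral_uniformOn x hcont.measurable, Finset.expect_sub_distrib] at hbary
  simp only [mul_one, Real.rpow_two, convexityConst_two] at hflow hdiam
  rw [dist_comm b u] at hflow
  have hsq : dist u b ^ 2 ≤ (√(t : ℝ) * Δ) ^ 2 := by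
    rw [mul_pow, Real.sq_sqrt t.2.1.le]
    linarith [mul_le_mul_of_nonneg_left hdiam t.2.1.le, sq_nonneg (dist u b)]
  exact le_of_sq_le_sq hsq (by positivity)

lemma IsGlobalNPC.tendsto_flow (hM : IsGlobalNPC M) (β : ContractiveBary 1 M) :
    Tendsto (fun t => hM.flow le_rfl t β)
      (comap ((↑) : Ioc (0 : ℝ) 1 → ℝ) (𝓝[>] 0)) (𝓝 hM.canonicalBary) := by
  rw [tendsto_iff_edist_tendsto_0]
  refine tendsto_of_tendsto_of_tendsto_of_le_of_le tendsto_const_nhds ?_ (fun _ => zero_le)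
    fun t => hM.edist_flow_canonicalBary_le t β
  have hsqrt : Tendsto (fun t : ℝ => ENNReal.ofReal √t) (𝓝 0) (𝓝 0) :=
    (ENNReal.continuous_ofReal.comp Real.continuous_sqrt).tendsto' 0 0 (by simp)
  exact (hsqrt.mono_left nhdsWithin_le_nhds).comp tendsto_comap

end Barycenter

theorem theorem5p5 {M : Type*} [MetricSpace M] [MeasurableSpace M] [BorelSpace M]
    (hM : IsGlobalNPC M) (p : ℝ) (hp : 1 ≤ p) :
    ∃ hmem : ∀ (x : M), ∀ t ∈ Set.Icc (0 : ℝ) 1, ∀ μ : ProbP p M,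
        IsProbPMoment p (geodMeasure x t μ.1),
    ∃ Φ : Set.Ioc (0 : ℝ) 1 → ContractiveBary p M → ContractiveBary p M,
      -- `Φ` is a continuous semiflow of the multiplicative semigroup `(0,1]`
      Continuous (fun a : Set.Ioc (0 : ℝ) 1 × ContractiveBary p M => Φ a.1 a.2) ∧
      (∀ β, Φ 1 β = β) ∧
      (∀ s t β, Φ t (Φ s β) = Φ (t * s) β) ∧
      -- the characterization
      (∀ (t : Set.Ioc (0 : ℝ) 1) (β : ContractiveBary p M) (μ : ProbP p M) (x : M),
        x = (Φ t β).1 μ ↔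
          x = β.1 ⟨geodMeasure x t μ.1, hmem x t (Set.Ioc_subset_Icc_self t.2) μ⟩) ∧
      -- the estimate
      (∀ (t s : Set.Ioc (0 : ℝ) 1) (β : ContractiveBary p M),
        edist (Φ t β) (Φ s β) ≤ ENNReal.ofReal
          (((convexityConst (2 * p) * ((s : ℝ) + t) + 2 * (2 - convexityConst (2 * p))) / 4)
            ^ (1 / (2 * p)))) ∧
      -- the limit for `p = 1`
      (p = 1 → ∃ bar : ContractiveBary p M, IsCanonicalBarycentricMap bar ∧
        ∀ β, Tendsto (fun t => Φ t β)
          (comap ((↑) : Set.Ioc (0 : ℝ) 1 → ℝ) (𝓝[>] 0)) (𝓝 bar)) := by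
  refine ⟨fun x t ht μ => hM.isProbPMoment_geodMeasure hp x ht μ, hM.flow hp,
    hM.continuous_flow hp, hM.flow_one hp, hM.flow_flow hp, hM.eq_flow_iff hp,
    hM.edist_flow_flow_le hp, ?_⟩
  rintro rfl
  exact ⟨hM.canonicalBary, hM.isCanonical_canonicalBary, hM.tendsto_flow⟩
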